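/- Let $\mathbb F$ be a field, let $d,n\ge 1$ be integers, and let $T=\sum_{i_1,\dots,i_d=1}^n t_{i_1,\dots,i_d}\,x^{(1)}_{i_1}\cdots x^{(d)}_{i_d}$ be a $d$-mode tensor over $\mathbb F$ with all modes of dimension $n$, viewed as a set-multilinear polynomial. Its Kronecker power $T^{\otimes k}$ is the $d$-mode tensor of dimension $n^k$ (modes indexed by $[n]^k$) whose coefficient at $(\mathbf i_1,\dots,\mathbf i_d)$, $\mathbf i_j=(i_{j,1},\dots,i_{j,k})\in[n]^k$, is $\prod_{l=1}^k t_{i_{1,l},\dots,i_{d,l}}$. Let $\mathrm{CC}(p)$ be the smallest size (number of wires) of an arithmetic circuit computing the polynomial $p$, where circuits are finite directed acyclic graphs whose sources are labelled by field elements or variables, whose other vertices are sum or product gates of unbounded fan-in, and whose wires carry scalars from $\mathbb F$. The asymptotic circuit complexity exponent of $T$ is $$\eta(T)=\inf\{\beta\ge 0:\ \mathrm{CC}(T^{\otimes k})\le O(n^{k\beta})\ \text{as } k\to\infty\}.$$ Let $\mathrm{ltw}(K_d)$ be the treewidth of the line graph of the complete graph $K_d$ on $d$ vertices (where the graph without vertices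 has treewidth $-1$). Then the set of such $\beta$ is non-empty, $$\frac2d\bigl(\mathrm{ltw}(K_d)+1\bigr)=\frac d2+1-\frac{7+(-1)^d}{4d}<\frac d2+1,$$ and, if $d\ge 2$, $$\eta(T)\le\frac2d\bigl(\mathrm{ltw}(K_d)+1\bigr).$$ In all cases $d\ge1$ we have $\eta(T)<\frac d2+1$. -/

import Mathlib

open Filter Asymptotics

noncomputable section

/-! ### Tensors as coefficient arrays and as set-multilinear polynomials -/

/-- A tensor over `F` with `d` modes, the indeterminates of each mode being indexed by `I`:
its array of coefficients. `Tensor F d (Fin n)` is the space written `(F^n)^{⊗ d}`. -/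
abbrev Tensor (F : Type*) (d : ℕ) (I : Type*) := (Fin d → I) → F

namespace Tensor

variable {F : Type*} [Field F] {d : ℕ}

/-- The set-multilinear polynomial `∑ t_{i_1,…,i_d} x^{(1)}_{i_1} ⋯ x^{(d)}_{i_d}` of a tensor;
the indeterminate `(j, a)` is `x^{(j)}_a`. -/
def toPoly {I : Type*} [Fintype I] (T : Tensor F d I) : MvPolynomial (Fin d × I) F :=
  ∑ i : Fin d → I, MvPolynomial.C (T i) * ∏ j, MvPolynomial.X (j, i j)

/-- The Kronecker product of two `d`-mode tensors; the `j`-th mode of the product is indexed by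
the Cartesian product of the index sets of the `j`-th modes. -/
def kron {I J : Type*} (S : Tensor F d I) (T : Tensor F d J) : Tensor F d (I × J) :=
  fun i => S (fun j => (i j).1) * T (fun j => (i j).2)

/-- The Kronecker power `T^{⊗ k}`; its modes are indexed by `k`-tuples of indices. -/
def kronPow {I : Type*} (T : Tensor F d I) (k : ℕ) : Tensor F d (Fin k → I) :=
  fun i => ∏ l : Fin k, T (fun j => i j l)

/-- Sanity check: under the bijection of `I^{k+1}` with `I × I^k`, the power `T^{⊗ (k+1)}` is the
Kronecker product of `T` with `T^{⊗ k}`. -/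
theorem kronPow_succ {I : Type*} (T : Tensor F d I) (k : ℕ) (i : Fin d → Fin (k + 1) → I) :
    kronPow T (k + 1) i = kron T (kronPow T k) (fun j => (i j 0, Fin.tail (i j))) := by
  simp [kronPow, kron, Fin.prod_univ_succ, Fin.tail]

end Tensor

/-! ### Arithmetic circuits -/

/-- Labels of the vertices of an arithmetic circuit over `F[X]`. -/
inductive GateLabel (F X : Type*)
  | const (a : F)
  | var (x : X)
  | add
  | mul

/-- The labels reserved for inputs. -/
@[reducible] def GateLabel.IsInput {F X : Type*} : GateLabel F X → Prop
  | .const _ => True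
  | .var _ => True
  | .add => False
  | .mul => False

/-- An arithmetic circuit over `F[X]`: a finite directed acyclic graph (on a finite vertex set,
well-foundedness of the wire relation means that there is no directed cycle) whose sources are
labelled by elements of `F` or by variables, whose other vertices are labelled `+` or `×` (with
unbounded fan-in), and whose wires `(u, v)` carry a scalar `coeff u v` (the values of `coeff` at
pairs that are not wires are irrelevant). -/
structure ArithCircuit (F X : Type*) where
  V : Type
  [fintypeV : Fintype V]
  wires : Finset (V × V)
  acyclic : WellFounded fun u v : V => (u, v) ∈ wires
  label : V → GateLabel F X
  isInput_iff : ∀ v, (label v).IsInput ↔ ∀ u, (u, v) ∉ wires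
  coeff : V → V → F

namespace ArithCircuit

attribute [instance] ArithCircuit.fintypeV

variable {F X : Type*}

/-- The size of a circuit is its number of wires. -/
def size (c : ArithCircuit F X) : ℕ := c.wires.card

open Classical in
/-- The vertices from which a wire leads to `v`. -/
def preds (c : ArithCircuit F X) (v : c.V) : Finset c.V :=
  Finset.univ.filter fun u => (u, v) ∈ c.wires

theorem mem_preds (c : ArithCircuit F X) {u v : c.V} : u ∈ c.preds v ↔ (u, v) ∈ c.wires := by
  simp [preds]

variable [Field F]

/-- The polynomial computed at a vertex, by recursion along the wires. -/
def value (c : ArithCircuit F X) : c.V → MvPolynomial X F :=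
  c.acyclic.fix fun v ih =>
    match c.label v with
    | .const a => MvPolynomial.C a
    | .var x => MvPolynomial.X x
    | .add => ∑ u ∈ (c.preds v).attach,
        MvPolynomial.C (c.coeff u.1 v) * ih u.1 (c.mem_preds.1 u.2)
    | .mul => ∏ u ∈ (c.preds v).attach,
        (MvPolynomial.C (c.coeff u.1 v) * ih u.1 (c.mem_preds.1 u.2))

theorem value_eq (c : ArithCircuit F X) (v : c.V) :
    c.value v = match c.label v with
      | .const a => MvPolynomial.C a
      | .var x => MvPolynomial.X x
      | .add => ∑ u ∈ c.preds v, MvPolynomial.C (c.coeff u v) * c.value u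
      | .mul => ∏ u ∈ c.preds v, (MvPolynomial.C (c.coeff u v) * c.value u) := by
  rw [value, WellFounded.fix_eq]
  cases c.label v with
  | const a => rfl
  | var x => rfl
  | add => exact Finset.sum_attach (c.preds v) fun u => MvPolynomial.C (c.coeff u v) * c.value u
  | mul => exact Finset.prod_attach (c.preds v) fun u => MvPolynomial.C (c.coeff u v) * c.value u

/-- A circuit computes `p` if `p` is the polynomial at one of its outputs, i.e. sinks. -/
def Computes (c : ArithCircuit F X) (p : MvPolynomial X F) : Prop :=
  ∃ v : c.V, (∀ w, (v, w) ∉ c.wires) ∧ c.value v = p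

/-- The circuit with a single input vertex and no wires. -/
@[reducible] def single (l : GateLabel F X) (hl : l.IsInput) : ArithCircuit F X where
  V := Unit
  wires := ∅
  acyclic := ⟨fun a => ⟨a, fun _ h => absurd h (Finset.notMem_empty _)⟩⟩
  label := fun _ => l
  isInput_iff := fun _ => by simp [hl]
  coeff := fun _ _ => 1

open Classical in
/-- The circuit that feeds the vertices `o i` of the disjoint circuits `c i` into a new gate. -/
@[reducible] def join (c : Bool → ArithCircuit F X) (o : ∀ i, (c i).V) (l : GateLabel F X)
    (hl : ¬ l.IsInput) : ArithCircuit F X where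
  V := Option (Σ i, (c i).V)
  wires := Finset.univ.filter fun e => match e with
    | (some u, some v) => ∃ i, ∃ a b : (c i).V, (a, b) ∈ (c i).wires ∧ u = ⟨i, a⟩ ∧ v = ⟨i, b⟩
    | (some u, none) => u = ⟨u.1, o u.1⟩
    | (none, _) => False
  acyclic := by
    have h1 : ∀ (i : Bool) (a : (c i).V), Acc (fun u v : Option (Σ i, (c i).V) =>
        (u, v) ∈ Finset.univ.filter fun e : Option (Σ i, (c i).V) × Option (Σ i, (c i).V) =>
          match e with
          | (some u, some v) =>
            ∃ i, ∃ a b : (c i).V, (a, b) ∈ (c i).wires ∧ u = ⟨i, a⟩ ∧ v = ⟨i, b⟩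
          | (some u, none) => u = ⟨u.1, o u.1⟩
          | (none, _) => False) (some ⟨i, a⟩) := by
      intro i a
      induction a using (c i).acyclic.induction with
      | _ a ih =>
        refine ⟨_, fun u hu => ?_⟩
        rcases u with _ | ⟨i', u⟩
        · simp at hu
        · simp only [Finset.mem_filter, Finset.mem_univ, true_and] at hu
          obtain ⟨j, p, q, hpq, h, h'⟩ := hu
          cases h
          cases h'
          exact ih _ hpq
    refine ⟨fun v => ?_⟩
    rcases v with _ | ⟨i, a⟩
    · refine ⟨_, fun u hu => ?_⟩
      rcases u with _ | ⟨i', u⟩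
      · simp at hu
      · exact h1 _ _
    · exact h1 i a
  label := fun v => match v with
    | none => l
    | some v => (c v.1).label v.2
  isInput_iff := by
    rintro (_ | ⟨i, a⟩)
    · simp only [hl, false_iff, not_forall, not_not]
      exact ⟨some ⟨true, o true⟩, by simp⟩
    · simp only [(c i).isInput_iff]
      constructor
      · rintro h (_ | ⟨j, u⟩) hu
        · simp at hu
        · simp only [Finset.mem_filter, Finset.mem_univ, true_and] at hu
          obtain ⟨j, p, q, hpq, h2, h'⟩ := hu
          cases h2
          cases h'
          exact h _ hpq
      · intro h u hu
        refine h (some ⟨i, u⟩) ?_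
        simp only [Finset.mem_filter, Finset.mem_univ, true_and]
        exact ⟨i, u, a, hu, rfl, rfl⟩
  coeff := fun u v => match u, v with
    | some u, some v => if h : u.1 = v.1 then (c v.1).coeff (h ▸ u.2) v.2 else 1
    | _, _ => 1

theorem join_preds_some (c : Bool → ArithCircuit F X) (o : ∀ i, (c i).V) (l : GateLabel F X)
    (hl : ¬ l.IsInput) (i : Bool) (a : (c i).V) :
    (join c o l hl).preds (some ⟨i, a⟩) =
      ((c i).preds a).map ⟨fun u => some ⟨i, u⟩, fun u v h => by simpa using h⟩ := by
  ext u
  rw [mem_preds]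
  simp only [join, Finset.mem_filter, Finset.mem_univ, true_and, Finset.mem_map,
    mem_preds]
  rcases u with _ | ⟨j, u⟩
  · simp
  · constructor
    · rintro ⟨j, p, q, hpq, h2, h'⟩
      cases h2
      cases h'
      exact ⟨_, hpq, rfl⟩
    · rintro ⟨p, hp, h⟩
      cases h
      exact ⟨i, p, a, hp, rfl, rfl⟩

theorem join_preds_none (c : Bool → ArithCircuit F X) (o : ∀ i, (c i).V) (l : GateLabel F X)
    (hl : ¬ l.IsInput) :
    (join c o l hl).preds none =
      Finset.univ.map ⟨fun i => some ⟨i, o i⟩, fun u v h => by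
        simp only [Option.some.injEq, Sigma.mk.injEq] at h; exact h.1⟩ := by
  ext u
  rw [mem_preds]
  simp only [join, Finset.mem_filter, Finset.mem_univ, true_and, Finset.mem_map]
  rcases u with _ | ⟨j, u⟩
  · simp
  · constructor
    · intro h
      exact ⟨j, congrArg some h.symm⟩
    · rintro ⟨i, h⟩
      cases h
      rfl

theorem join_value_some (c : Bool → ArithCircuit F X) (o : ∀ i, (c i).V) (l : GateLabel F X)
    (hl : ¬ l.IsInput) (i : Bool) (a : (c i).V) :
    (join c o l hl).value (some ⟨i, a⟩) = (c i).value a := by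
  induction a using (c i).acyclic.induction with
  | _ a ih =>
    rw [value_eq, value_eq, join_preds_some]
    simp only [Finset.sum_map, Finset.prod_map]
    have h1 : (join c o l hl).label (some ⟨i, a⟩) = (c i).label a := rfl
    have h2 : ∀ u, (join c o l hl).coeff (some ⟨i, u⟩) (some ⟨i, a⟩) = (c i).coeff u a := by
      intro u; simp
    rw [h1]
    cases (c i).label a with
    | const a => rfl
    | var x => rfl
    | add => exact Finset.sum_congr rfl fun u hu =>
        congrArg₂ (fun x y => MvPolynomial.C x * y) (h2 u) (ih u ((c i).mem_preds.1 hu))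
    | mul => exact Finset.prod_congr rfl fun u hu =>
        congrArg₂ (fun x y => MvPolynomial.C x * y) (h2 u) (ih u ((c i).mem_preds.1 hu))

/-- Every polynomial is computed by some circuit, so that the minimum defining
`circuitComplexity` is over a non-empty set. -/
theorem exists_computes (p : MvPolynomial X F) : ∃ c : ArithCircuit F X, c.Computes p := by
  have hjoin : ∀ p q : MvPolynomial X F, (∃ c : ArithCircuit F X, c.Computes p) →
      (∃ c : ArithCircuit F X, c.Computes q) → (∃ c : ArithCircuit F X, c.Computes (p + q)) ∧
        ∃ c : ArithCircuit F X, c.Computes (p * q) := by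
    rintro p q ⟨c₁, o₁, -, h₁⟩ ⟨c₂, o₂, -, h₂⟩
    let c : Bool → ArithCircuit F X := fun b => if b then c₁ else c₂
    let o : ∀ i, (c i).V := fun b => match b with
      | true => o₁
      | false => o₂
    have ht : (c true).value (o true) = p := h₁
    have hf : (c false).value (o false) = q := h₂
    have hs : ∀ (l : GateLabel F X) (hl : ¬ l.IsInput) w,
        ((none : Option (Σ i, (c i).V)), w) ∉ (join c o l hl).wires := by
      intro l hl w; simp [join]
    have hv : ∀ (l : GateLabel F X) (hl : ¬ l.IsInput) (i : Bool),
        MvPolynomial.C ((join c o l hl).coeff (some ⟨i, o i⟩) none) *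
          (join c o l hl).value (some ⟨i, o i⟩) = (c i).value (o i) := by
      intro l hl i
      rw [join_value_some, map_one, one_mul]
    refine ⟨⟨join c o .add not_false, none, hs _ _, ?_⟩,
      ⟨join c o .mul not_false, none, hs _ _, ?_⟩⟩
    · rw [value_eq, join_preds_none]
      refine (Finset.sum_map _ _ _).trans ((Fintype.sum_bool _).trans ?_)
      exact congrArg₂ (· + ·) ((hv _ _ true).trans ht) ((hv _ _ false).trans hf)
    · rw [value_eq, join_preds_none]
      refine (Finset.prod_map _ _ _).trans ((Fintype.prod_bool _).trans ?_)
      exact congrArg₂ (· * ·) ((hv _ _ true).trans ht) ((hv _ _ false).trans hf)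
  induction p using MvPolynomial.induction_on with
  | C a => exact ⟨single (.const a) trivial, (), by simp [single], by rw [value_eq]⟩
  | add p q hp hq => exact (hjoin p q hp hq).1
  | mul_X p x hp =>
    exact (hjoin p _ hp ⟨single (.var x) trivial, (), by simp [single], by rw [value_eq]⟩).2

end ArithCircuit

/-- The arithmetic circuit complexity of a polynomial: the size of a smallest circuit for it. -/
def circuitComplexity {F X : Type*} [Field F] (p : MvPolynomial X F) : ℕ :=
  sInf {s | ∃ c : ArithCircuit F X, c.Computes p ∧ c.size = s}

namespace Tensor

variable {F : Type*} [Field F] {d n : ℕ}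

/-- The set of all `β ≥ 0` with `CC(T^{⊗ k}) ≤ O(n^{k β})` as `k → ∞`. -/
def circuitExponents (T : Tensor F d (Fin n)) : Set ℝ :=
  {β | 0 ≤ β ∧ (fun k : ℕ => (circuitComplexity (T.kronPow k).toPoly : ℝ))
    =O[atTop] fun k : ℕ => (n : ℝ) ^ ((k : ℝ) * β)}

/-- The asymptotic circuit complexity exponent `η(T)`. -/
def circuitExponent (T : Tensor F d (Fin n)) : ℝ := sInf T.circuitExponents

end Tensor

/-! ### Treewidth -/

namespace SimpleGraph

/-- A tree decomposition of a graph: a finite tree with a bag of vertices at every node. -/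
structure TreeDecomposition {V : Type*} (G : SimpleGraph V) where
  Node : Type
  [fintypeNode : Fintype Node]
  tree : SimpleGraph Node
  isTree : tree.IsTree
  bag : Node → Finset V
  exists_mem_bag : ∀ v, ∃ a, v ∈ bag a
  exists_edge_bag : ∀ u v, G.Adj u v → ∃ a, u ∈ bag a ∧ v ∈ bag a
  mem_bag_of_path : ∀ (a c : Node) (p : tree.Walk a c), p.IsPath → ∀ b ∈ p.support,
    ∀ v, v ∈ bag a → v ∈ bag c → v ∈ bag b

attribute [instance] TreeDecomposition.fintypeNode

/-- The width of a tree decomposition: the maximal size of a bag, minus one. -/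
def TreeDecomposition.width {V : Type*} {G : SimpleGraph V} (D : G.TreeDecomposition) : ℤ :=
  ((Finset.univ.sup fun a => (D.bag a).card : ℕ) : ℤ) - 1

/-- The treewidth of a finite graph: the minimal width of a tree decomposition. It is an integer
because the graph without vertices has treewidth `-1`. -/
def treewidth {V : Type*} [Finite V] (G : SimpleGraph V) : ℤ :=
  sInf {w | ∃ D : G.TreeDecomposition, D.width = w}

/-- The line-treewidth of a finite graph: the treewidth of its line graph. -/
def lineTreewidth {V : Type*} [Finite V] (G : SimpleGraph V) : ℤ := G.lineGraph.treewidth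

end SimpleGraph

end

/-! Upper bound. Spread the `k` factors of `T^{⊗ k}` evenly over the `d` modes, so that block `c`
has at most `k/d + 1` factors. The multi-index of mode `j` splits into its restrictions to the
blocks, one summation variable for each ordered pair `(c, j)`, with at most `M = n^(k/d+1)` values.
The coefficient contributed by block `j` involves only pairs `(j, ·)`, and the indeterminate of mode
`j` only pairs `(·, j)`. So the polynomial is a sum of products of `d` factors, one at each vertex
of `K_d`, where the factor at `j` sees only the loop `(j, j)` and the two variables on each edge at
`j`.

Such a sum is evaluated by eliminating variables along a path decomposition of the line graph of
`K_d`. The loop occurs in one factor only and is summed out before multiplying (`M^(2(d-1)+1)`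
wires). Every other step concerns the variables on edges `uv` with `u ≤ i ≤ v`. There are at most
`maxBag d` such edges, so `derives_sum_prod` costs `O(M^(2 maxBag d))` plus the loop terms, which
gives the exponent `2 maxBag d / d` once `d ≥ 3`. For `d = 2` the loop term would dominate. There
the tensor is a matrix, and multiplying by its Kronecker power one factor at a time gives exponent
`1`. For `d = 1` the exponent `1` suffices.

Treewidth. The bags of the same path decomposition have at most `maxBag d` edges. Conversely,
suppose all bags of a tree decomposition are smaller. Deleting the edges of a bag from `K_d` leaves
a component with more than half of the vertices (`exists_large_component`, a convexity estimate with
a tie-break at one vertex). Its remaining edges all lie in one direction of the tree, so every node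
points to a neighbour, and some tree edge is traversed both ways. The two large components at its
ends share a vertex, whose remaining edges would have to lie on both sides of that tree edge
(`maxBag_le_sup_card`). -/

noncomputable section

/-! ### Adding a gate to a circuit -/

namespace ArithCircuit

variable {F X : Type*} [Field F]

/-- The wires of a circuit extended by a gate `none` that is fed by the vertices in `A`. -/
def IsExtendWire {V : Type} (w : Finset (V × V)) (A : Finset V) : Option V → Option V → Prop
  | some u, some v => (u, v) ∈ w
  | some u, none => u ∈ A
  | none, _ => False

theorem IsExtendWire.acc {V : Type} {w : Finset (V × V)} (A : Finset V)
    (hw : WellFounded fun u v : V => (u, v) ∈ w) (a : V) : Acc (IsExtendWire w A) (some a) := by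
  induction a using hw.induction with
  | _ a ih =>
    refine ⟨_, fun u hu => ?_⟩
    rcases u with _ | u
    · exact hu.elim
    · exact ih u hu

theorem IsExtendWire.wellFounded {V : Type} {w : Finset (V × V)} (A : Finset V)
    (hw : WellFounded fun u v : V => (u, v) ∈ w) : WellFounded (IsExtendWire w A) := by
  refine ⟨fun v => ?_⟩
  rcases v with _ | a
  · refine ⟨_, fun u hu => ?_⟩
    rcases u with _ | u
    · exact hu.elim
    · exact IsExtendWire.acc A hw u
  · exact IsExtendWire.acc A hw a

open Classical in
/-- The circuit obtained by adding one gate `l` that is fed by the vertices in `A`. -/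
@[reducible] def extend (c : ArithCircuit F X) (A : Finset c.V) (hA : A.Nonempty)
    (l : GateLabel F X) (hl : ¬ l.IsInput) (κ : c.V → F) : ArithCircuit F X where
  V := Option c.V
  wires := Finset.univ.filter fun e => IsExtendWire c.wires A e.1 e.2
  acyclic := by
    simp only [Finset.mem_filter, Finset.mem_univ, true_and]
    exact IsExtendWire.wellFounded A c.acyclic
  label := fun v => match v with
    | none => l
    | some v => c.label v
  isInput_iff := by
    simp only [Finset.mem_filter, Finset.mem_univ, true_and]
    rintro (_ | a)
    · simp only [hl, false_iff, not_forall, not_not]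
      obtain ⟨u, hu⟩ := hA
      exact ⟨some u, hu⟩
    · simp only [c.isInput_iff]
      constructor
      · rintro h (_ | u) hu
        · exact hu
        · exact h _ hu
      · exact fun h u => h (some u)
  coeff := fun u v => match u, v with
    | some u, some v => c.coeff u v
    | some u, none => κ u
    | none, _ => 1

section Extend

variable (c : ArithCircuit F X) (A : Finset c.V) (hA : A.Nonempty) (l : GateLabel F X)
    (hl : ¬ l.IsInput) (κ : c.V → F)

theorem extend_mem_wires (u v : Option c.V) :
    (u, v) ∈ (c.extend A hA l hl κ).wires ↔ IsExtendWire c.wires A u v := by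
  simp

theorem extend_size_le : (c.extend A hA l hl κ).size ≤ c.size + A.card := by
  classical
  refine (Finset.card_le_card (t := c.wires.image (fun e => (some e.1, some e.2)) ∪
    A.image fun u => (some u, none)) ?_).trans ((Finset.card_union_le _ _).trans
    (add_le_add Finset.card_image_le Finset.card_image_le))
  rintro ⟨u, v⟩ h
  rw [extend_mem_wires] at h
  rcases u with _ | u
  · exact h.elim
  rcases v with _ | v
  · exact Finset.mem_union_right _ (Finset.mem_image_of_mem _ h)
  · exact Finset.mem_union_left _ (Finset.mem_image.2 ⟨(u, v), h, rfl⟩)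

theorem extend_preds_some (a : c.V) : (c.extend A hA l hl κ).preds (some a) =
    (c.preds a).map Function.Embedding.some := by
  ext u
  rw [mem_preds, extend_mem_wires]
  rcases u with _ | u <;> simp [IsExtendWire, mem_preds]

theorem extend_preds_none : (c.extend A hA l hl κ).preds none =
    A.map Function.Embedding.some := by
  ext u
  rw [mem_preds, extend_mem_wires]
  rcases u with _ | u <;> simp [IsExtendWire]

theorem extend_value_some (a : c.V) : (c.extend A hA l hl κ).value (some a) = c.value a := by
  induction a using c.acyclic.induction with
  | _ a ih =>
    rw [value_eq, value_eq, extend_preds_some]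
    have h1 : (c.extend A hA l hl κ).label (some a) = c.label a := rfl
    rw [h1]
    cases c.label a with
    | const a => rfl
    | var x => rfl
    | add => exact (Finset.sum_map _ _ _).trans (Finset.sum_congr rfl fun u hu =>
        congrArg (fun y => MvPolynomial.C (c.coeff u a) * y) (ih u (c.mem_preds.1 hu)))
    | mul => exact (Finset.prod_map _ _ _).trans (Finset.prod_congr rfl fun u hu =>
        congrArg (fun y => MvPolynomial.C (c.coeff u a) * y) (ih u (c.mem_preds.1 hu)))

/-- Adding a sum gate to a circuit. -/
theorem exists_add_gate (hA : A.Nonempty) : ∃ (c' : ArithCircuit F X) (f : c.V → c'.V) (o : c'.V),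
    c'.size ≤ c.size + A.card ∧ (∀ a, c'.value (f a) = c.value a) ∧ (∀ a, f a ≠ o) ∧
    (∀ w, (o, w) ∉ c'.wires) ∧ c'.value o = ∑ u ∈ A, MvPolynomial.C (κ u) * c.value u := by
  refine ⟨c.extend A hA .add not_false κ, some, none, c.extend_size_le _ _ _ _ _,
    c.extend_value_some _ _ _ _ _, fun _ => nofun,
    fun w h => (extend_mem_wires c A hA _ _ κ none w).1 h, ?_⟩
  rw [value_eq, extend_preds_none]
  exact (Finset.sum_map _ _ _).trans (Finset.sum_congr rfl fun u _ =>
    congrArg (fun y => MvPolynomial.C (κ u) * y) (extend_value_some c A hA _ _ κ u))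

/-- Adding a product gate to a circuit. -/
theorem exists_mul_gate (hA : A.Nonempty) : ∃ (c' : ArithCircuit F X) (f : c.V → c'.V) (o : c'.V),
    c'.size ≤ c.size + A.card ∧ (∀ a, c'.value (f a) = c.value a) ∧
    c'.value o = ∏ u ∈ A, c.value u := by
  refine ⟨c.extend A hA .mul not_false fun _ => 1, some, none, c.extend_size_le _ _ _ _ _,
    c.extend_value_some _ _ _ _ _, ?_⟩
  rw [value_eq, extend_preds_none]
  refine (Finset.prod_map _ _ _).trans (Finset.prod_congr rfl fun u _ => ?_)
  rw [← extend_value_some c A hA .mul not_false fun _ => 1]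
  exact (congrArg (· * _) (map_one _)).trans (one_mul _)

end Extend

end ArithCircuit

/-! ### Calculus of circuit costs -/

/-- Some circuit with at most `s` wires has all polynomials of `S` among the polynomials at its
vertices. -/
def HasCircuit {F X : Type*} [Field F] (S : Set (MvPolynomial X F)) (s : ℕ) : Prop :=
  ∃ c : ArithCircuit F X, c.size ≤ s ∧ ∀ p ∈ S, ∃ v, c.value v = p

/-- Every circuit that has the polynomials of `S` at its vertices can be extended by at most `m`
wires so that it has those of `P` as well. -/
def Derives {F X : Type*} [Field F] (S P : Set (MvPolynomial X F)) (m : ℕ) : Prop :=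
  ∀ U s, S ⊆ U → HasCircuit U s → HasCircuit (U ∪ P) (s + m)

section Derives

variable {F X : Type*} [Field F] {S P Q : Set (MvPolynomial X F)} {s m m' : ℕ}

theorem HasCircuit.mono {S' : Set (MvPolynomial X F)} {s' : ℕ} (h : HasCircuit S s) (hS : S' ⊆ S)
    (hs : s ≤ s') : HasCircuit S' s' := by
  obtain ⟨c, hc, h⟩ := h
  exact ⟨c, hc.trans hs, fun p hp => h p (hS hp)⟩

/-- The vertex carrying `p` may have outgoing wires. The extra wire copies it to a new gate, which
is a sink. -/
theorem HasCircuit.circuitComplexity_le {p : MvPolynomial X F} (h : HasCircuit S s) (hp : p ∈ S) :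
    circuitComplexity p ≤ s + 1 := by
  obtain ⟨c, hc, h⟩ := h
  obtain ⟨v, hv⟩ := h p hp
  obtain ⟨c', f, o, hc', -, -, hs, ho⟩ :=
    c.exists_add_gate {v} (fun _ => 1) (Finset.singleton_nonempty v)
  have hle : circuitComplexity p ≤ c'.size :=
    Nat.sInf_le ⟨c', ⟨o, hs, by simp [ho, hv]⟩, rfl⟩
  exact hle.trans (hc'.trans (by simpa using hc))

theorem hasCircuit_insert_one_range_X {X : Type} [Fintype X] :
    HasCircuit (insert 1 (Set.range (MvPolynomial.X : X → MvPolynomial X F))) 0 := by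
  let c : ArithCircuit F X :=
    { V := Option X
      wires := ∅
      acyclic := ⟨fun a => ⟨a, fun _ h => absurd h (Finset.notMem_empty _)⟩⟩
      label := fun v => v.elim (.const 1) .var
      isInput_iff := by rintro (_ | v) <;> simp
      coeff := fun _ _ => 1 }
  refine ⟨c, le_of_eq (Finset.card_empty), ?_⟩
  rintro p (rfl | ⟨x, rfl⟩)
  · exact ⟨none, by rw [c.value_eq]; exact map_one _⟩
  · exact ⟨some x, by rw [c.value_eq]; rfl⟩

theorem Derives.mono {S' P' : Set (MvPolynomial X F)} (h : Derives S P m) (hS : S ⊆ S')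
    (hP : P' ⊆ P) (hm : m ≤ m') : Derives S' P' m' := fun U s hU hs =>
  (h U s (hS.trans hU) hs).mono (Set.union_subset_union_right _ hP) (by lia)

/-- Costs add because `Derives` quantifies over all supersets `U`: nothing computed earlier is lost.
-/
theorem Derives.trans (h : Derives S P m) (h' : Derives (S ∪ P) Q m') :
    Derives S (P ∪ Q) (m + m') := fun U s hU hs => by
  have := h' _ _ (Set.union_subset_union_left P hU) (h U s hU hs)
  rwa [Set.union_assoc, add_assoc] at this

theorem Derives.biUnion {ι : Type*} (t : Finset ι) {P : ι → Set (MvPolynomial X F)}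
    (h : ∀ i ∈ t, Derives S (P i) m) : Derives S (⋃ i ∈ t, P i) (t.card * m) := by
  classical
  induction t using Finset.induction_on with
  | empty => intro U s _ hs; simpa using hs
  | insert i t hi ih =>
    have := (ih fun j hj => h j (Finset.mem_insert_of_mem hj)).trans
      ((h i (Finset.mem_insert_self _ _)).mono Set.subset_union_left subset_rfl le_rfl)
    refine this.mono subset_rfl ?_ ?_
    · rw [Finset.set_biUnion_insert, Set.union_comm]
    · rw [Finset.card_insert_of_notMem hi]; lia

/-- One sum gate computes a linear combination. -/
theorem derives_sum {ι : Type*} (t : Finset ι) (ht : t.Nonempty) (κ : ι → F)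
    (g : ι → MvPolynomial X F) (hg : ∀ i ∈ t, g i ∈ S) :
    Derives S {∑ i ∈ t, MvPolynomial.C (κ i) * g i} t.card := by
  classical
  rintro U s hU ⟨c, hc, h⟩
  have hv : ∀ i : ι, ∃ v : c.V, i ∈ t → c.value v = g i := by
    obtain ⟨i₀, hi₀⟩ := ht
    obtain ⟨v₀, -⟩ := h _ (hU (hg i₀ hi₀))
    intro i
    by_cases hi : i ∈ t
    · obtain ⟨v, hv⟩ := h _ (hU (hg i hi))
      exact ⟨v, fun _ => hv⟩
    · exact ⟨v₀, fun h => absurd h hi⟩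
  choose w hw using hv
  -- Several indices may share a vertex, and parallel wires do not exist. The scalar on a wire is
  -- therefore the sum over the fibre of `w`.
  obtain ⟨c', f, o, hc', hf, -, -, ho⟩ := c.exists_add_gate (t.image w)
    (fun u => ∑ i ∈ t with w i = u, κ i) (ht.image w)
  refine ⟨c', hc'.trans (add_le_add hc Finset.card_image_le), ?_⟩
  rintro p (hp | rfl)
  · obtain ⟨v, hv⟩ := h p hp
    exact ⟨f v, by rw [hf, hv]⟩
  · refine ⟨o, ?_⟩
    rw [ho, ← Finset.sum_fiberwise_of_maps_to (fun i hi => Finset.mem_image_of_mem w hi)]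
    refine Finset.sum_congr rfl fun u _ => ?_
    rw [map_sum, Finset.sum_mul]
    refine Finset.sum_congr rfl fun i hi => ?_
    rw [Finset.mem_filter] at hi
    rw [← hw i hi.1, hi.2]

/-- A copy gate and a product gate compute a product of two polynomials. -/
theorem derives_mul {a b : MvPolynomial X F} (ha : a ∈ S) (hb : b ∈ S) :
    Derives S {a * b} 3 := by
  classical
  rintro U s hU ⟨c, hc, h⟩
  obtain ⟨v, hv⟩ := h _ (hU ha)
  obtain ⟨w, hw⟩ := h _ (hU hb)
  -- If `a` and `b` sit at the same vertex, the product gate would receive only one wire. The copy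
  -- `o` guarantees two distinct predecessors.
  obtain ⟨c', f, o, hc', hf, hne, -, ho⟩ :=
    c.exists_add_gate {v} (fun _ => 1) (Finset.singleton_nonempty v)
  obtain ⟨c'', f', o', hc'', hf', ho'⟩ :=
    c'.exists_mul_gate {o, f w} (Finset.insert_nonempty _ _)
  have hne' : o ∉ ({f w} : Finset c'.V) := by simpa using (hne w).symm
  rw [Finset.card_insert_of_notMem hne', Finset.card_singleton] at hc''
  rw [Finset.card_singleton] at hc'
  refine ⟨c'', by lia, ?_⟩
  rintro p (hp | rfl)
  · obtain ⟨u, hu⟩ := h p hp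
    exact ⟨f' (f u), by rw [hf', hf, hu]⟩
  · refine ⟨o', ?_⟩
    rw [ho', Finset.prod_insert hne', Finset.prod_singleton, ho, hf, hw]
    simp [hv]

end Derives

/-! ### Marginals of functions of finitely many variables -/

section Marginal

variable {ι : Type*} [DecidableEq ι] {D : ι → Type*} [∀ i, Fintype (D i)] {R : Type*}
  [CommSemiring R]

/-- The sum of `g` over all values of the variables in `s`. -/
def marginal (s : Finset ι) (g : (∀ i, D i) → R) (f : ∀ i, D i) : R :=
  ∑ h : ∀ i : s, D i, g (Function.updateFinset f s h)

theorem marginal_union {s t : Finset ι} (hst : Disjoint s t) (g : (∀ i, D i) → R) :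
    marginal (s ∪ t) g = marginal s (marginal t g) := by
  funext f
  simp only [marginal]
  rw [← (Equiv.piFinsetUnion D hst).sum_comp, Fintype.sum_prod_type]
  simp only [Function.updateFinset_updateFinset hst]

/-- The distributive law, on which the savings of variable elimination rest. -/
theorem marginal_mul_of_dependsOn {s : Finset ι} {u : Set ι} {φ : (∀ i, D i) → R}
    (hφ : DependsOn φ u) (hu : ∀ i ∈ s, i ∉ u) (g : (∀ i, D i) → R) :
    marginal s (fun f => g f * φ f) = fun f => marginal s g f * φ f := by
  funext f
  simp only [marginal, Finset.sum_mul]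
  refine Finset.sum_congr rfl fun h _ => congrArg _ (hφ fun i hi => ?_)
  rw [Function.updateFinset, dif_neg fun h => hu i h hi]

theorem dependsOn_marginal {s : Finset ι} {u v : Set ι} {g : (∀ i, D i) → R}
    (hg : DependsOn g u) (h : u ⊆ v ∪ s) : DependsOn (marginal s g) v := by
  intro f f' hf
  refine Finset.sum_congr rfl fun e _ => hg fun i hi => ?_
  by_cases his : i ∈ s
  · simp [Function.updateFinset, his]
  · simpa [Function.updateFinset, his] using hf i ((h hi).resolve_right his)

theorem marginal_univ [Fintype ι] (g : (∀ i, D i) → R) (f : ∀ i, D i) :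
    marginal Finset.univ g f = ∑ f', g f' := by
  refine Fintype.sum_equiv
    (⟨fun h i => h ⟨i, Finset.mem_univ i⟩, fun f i => f i, fun _ => rfl, fun _ => rfl⟩ :
      (∀ i : (Finset.univ : Finset ι), D i) ≃ ∀ i, D i) _ _ fun h => congrArg g ?_
  funext i
  simp [Function.updateFinset]

/-- The number of values of the variables in `t`. -/
theorem card_pi_finset_le {M : ℕ} (hM : ∀ i, Fintype.card (D i) ≤ M) (t : Finset ι) :
    (Finset.univ : Finset (∀ i : t, D i)).card ≤ M ^ t.card := by
  rw [Finset.card_univ, Fintype.card_pi]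
  refine (Finset.prod_le_pow_card Finset.univ (fun i : t => Fintype.card (D i)) M
    fun i _ => hM i).trans (le_of_eq ?_)
  simp

/-- A function that depends only on the variables in `t` takes all its values on a set of
assignments of size at most `M ^ #t`. -/
theorem exists_finset_range_eq [Fintype ι] [∀ i, Nonempty (D i)] {M : ℕ}
    (hM : ∀ i, Fintype.card (D i) ≤ M) (t : Finset ι) : ∃ B : Finset (∀ i, D i),
    B.card ≤ M ^ t.card ∧ ∀ {β : Type _} (g : (∀ i, D i) → β), DependsOn g t →
      ∀ f, ∃ f' ∈ B, g f' = g f := by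
  classical
  let e : ∀ i, D i := fun i => Classical.arbitrary _
  refine ⟨Finset.univ.image fun h : ∀ i : t, D i => Function.updateFinset e t h, ?_, ?_⟩
  · exact Finset.card_image_le.trans (card_pi_finset_le hM t)
  · intro β g hg f
    refine ⟨Function.updateFinset e t fun i => f i, Finset.mem_image_of_mem _ (Finset.mem_univ _),
      hg fun i hi => ?_⟩
    simp only [Finset.mem_coe] at hi
    simp [Function.updateFinset, hi]

end Marginal

/-! ### Cost of tabulating marginals and products -/

section Cost

variable {F X : Type*} [Field F] {S : Set (MvPolynomial X F)} {ι : Type*} [DecidableEq ι]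
  [Fintype ι] {D : ι → Type*} [∀ i, Fintype (D i)] [∀ i, Nonempty (D i)] {M : ℕ}

theorem derives_range_of_dependsOn (hM : ∀ i, Fintype.card (D i) ≤ M) {t : Finset ι} {m : ℕ}
    {g : (∀ i, D i) → MvPolynomial X F} (hg : DependsOn g t) (h : ∀ f, Derives S {g f} m) :
    Derives S (Set.range g) (M ^ t.card * m) := by
  obtain ⟨B, hB, hBg⟩ := exists_finset_range_eq hM t
  refine (Derives.biUnion B fun f _ => h f).mono subset_rfl ?_ (Nat.mul_le_mul_right _ hB)
  rintro _ ⟨f, rfl⟩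
  obtain ⟨f', hf', h⟩ := hBg g hg f
  exact Set.mem_biUnion hf' h.symm

/-- One sum gate for each assignment of the surviving variables `t`, with one wire for each
assignment of the eliminated variables `s`. -/
theorem derives_range_marginal (hM : ∀ i, Fintype.card (D i) ≤ M) {s t : Finset ι}
    (κ : (∀ i, D i) → F) {g : (∀ i, D i) → MvPolynomial X F} (hS : Set.range g ⊆ S)
    (ht : DependsOn (marginal s fun f => MvPolynomial.C (κ f) * g f) t) :
    Derives S (Set.range (marginal s fun f => MvPolynomial.C (κ f) * g f))
      (M ^ t.card * M ^ s.card) := by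
  refine derives_range_of_dependsOn hM ht fun f => ?_
  exact (derives_sum Finset.univ Finset.univ_nonempty
    (fun h => κ (Function.updateFinset f s h)) (fun h => g (Function.updateFinset f s h))
    fun h _ => hS ⟨_, rfl⟩).mono subset_rfl subset_rfl (card_pi_finset_le hM s)

theorem derives_range_mul (hM : ∀ i, Fintype.card (D i) ≤ M) {t : Finset ι}
    {a b : (∀ i, D i) → MvPolynomial X F} (ha : Set.range a ⊆ S) (hb : Set.range b ⊆ S)
    (ht : DependsOn (fun f => a f * b f) t) :
    Derives S (Set.range fun f => a f * b f) (M ^ t.card * 3) :=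
  derives_range_of_dependsOn hM ht fun f => derives_mul (ha ⟨f, rfl⟩) (hb ⟨f, rfl⟩)

end Cost

theorem derives_of_subset {F X : Type*} [Field F] {S P : Set (MvPolynomial X F)} (h : P ⊆ S) :
    Derives S P 0 := fun _ _ hU hs => hs.mono (Set.union_subset subset_rfl (h.trans hU)) le_rfl

/-! ### Counting pairs of modes in a bag -/

/-- The maximal number of edges of `K_d` in a bag of its canonical path decomposition. -/
def maxBag (d : ℕ) : ℕ := (d / 2 + 1) * ((d + 1) / 2) - 1

/-- With `a` modes up to `i` and `b` modes from `i` on, `i` is counted twice and the pair `(i, i)`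
is discarded. The product is largest for the balanced split. -/
theorem mul_sub_one_le_maxBag {a b d : ℕ} (h : a + b = d + 1) : a * b - 1 ≤ maxBag d := by
  refine Nat.sub_le_sub_right ?_ 1
  obtain ⟨e, rfl | rfl⟩ : ∃ e, d = 2 * e ∨ d = 2 * e + 1 := ⟨d / 2, by lia⟩
  · have h1 : 2 * e / 2 = e := by lia
    have h2 : (2 * e + 1) / 2 = e := by lia
    rw [h1, h2]
    rcases le_or_gt a e with h3 | h3 <;> zify at * <;> nlinarith
  · have h1 : (2 * e + 1) / 2 = e := by lia
    have h2 : (2 * e + 1 + 1) / 2 = e + 1 := by lia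
    rw [h1, h2]
    zify at *
    nlinarith [sq_nonneg ((a : ℤ) - e - 1)]

section Pairs

variable {d : ℕ}

/-- The pairs of modes before `i`. -/
def pairsBelow (d i : ℕ) : Finset (Fin d × Fin d) :=
  Finset.univ.filter fun p => p.1.1 < i ∧ p.2.1 < i

/-- The pairs of `i` with another mode. -/
def pairsAt (i : Fin d) : Finset (Fin d × Fin d) :=
  Finset.univ.filter fun p => p.1 ≠ p.2 ∧ (p.1 = i ∨ p.2 = i)

/-- The pairs of `i` with an earlier mode. -/
def pairsBelowAt (i : Fin d) : Finset (Fin d × Fin d) :=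
  Finset.univ.filter fun p => (p.1.1 < i.1 ∧ p.2 = i) ∨ (p.1 = i ∧ p.2.1 < i.1)

/-- The pairs of a mode before `i` with a mode that is not before `i`. -/
def pairsAcross (d i : ℕ) : Finset (Fin d × Fin d) :=
  Finset.univ.filter fun p => (p.1.1 < i ∧ i ≤ p.2.1) ∨ (i ≤ p.1.1 ∧ p.2.1 < i)

/-- The pairs of different modes between which `i` lies. -/
def pairsAround (i : Fin d) : Finset (Fin d × Fin d) :=
  Finset.univ.filter fun p =>
    p.1 ≠ p.2 ∧ ((p.1.1 ≤ i.1 ∧ i.1 ≤ p.2.1) ∨ (i.1 ≤ p.1.1 ∧ p.2.1 ≤ i.1))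

theorem card_pairsAt_le (i : Fin d) : (pairsAt i).card ≤ 2 * (d - 1) := by
  have h : pairsAt i ⊆ (Finset.univ.erase i).image (fun j => (i, j)) ∪
      (Finset.univ.erase i).image (fun j => (j, i)) := by
    rintro ⟨u, v⟩ h
    simp [pairsAt] at h ⊢
    grind
  refine (Finset.card_le_card h).trans ((Finset.card_union_le _ _).trans ?_)
  have h1 : (Finset.univ.erase i).card = d - 1 := by simp
  exact (add_le_add Finset.card_image_le Finset.card_image_le).trans (by lia)

theorem card_Iic_product_Ici_erase (i : Fin d) :
    ((Finset.Iic i ×ˢ Finset.Ici i).erase (i, i)).card ≤ maxBag d := by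
  rw [Finset.card_erase_of_mem (by simp), Finset.card_product, Fin.card_Iic, Fin.card_Ici]
  exact mul_sub_one_le_maxBag (by lia)

theorem card_pairsAround_le (i : Fin d) : (pairsAround i).card ≤ 2 * maxBag d := by
  have h : pairsAround i ⊆ (Finset.Iic i ×ˢ Finset.Ici i).erase (i, i) ∪
      ((Finset.Iic i ×ˢ Finset.Ici i).erase (i, i)).image Prod.swap := by
    rintro ⟨u, v⟩ h
    simp only [pairsAround, Finset.mem_filter, Finset.mem_univ, true_and, ne_eq] at h
    have h1 : ∀ a b : Fin d, a ≠ b → a.1 ≤ i.1 → i.1 ≤ b.1 →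
        (a, b) ∈ (Finset.Iic i ×ˢ Finset.Ici i).erase (i, i) := by
      intro a b hab ha hb
      simp only [Finset.mem_erase, Finset.mem_product, Finset.mem_Iic, Finset.mem_Ici, ne_eq,
        Prod.mk.injEq]
      exact ⟨fun h => hab (h.1.trans h.2.symm), ha, hb⟩
    rcases h with ⟨huv, h | h⟩
    · exact Finset.mem_union_left _ (h1 u v huv h.1 h.2)
    · exact Finset.mem_union_right _
        (Finset.mem_image.2 ⟨(v, u), h1 v u (Ne.symm huv) h.2 h.1, rfl⟩)
  refine (Finset.card_le_card h).trans ((Finset.card_union_le _ _).trans ?_)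
  exact (add_le_add (card_Iic_product_Ici_erase i) (Finset.card_image_le.trans
    (card_Iic_product_Ici_erase i))).trans (by lia)

/-- The variables surviving step `i` and those eliminated in it are disjoint and lie in the same
bag, so summation costs no more than one table over the bag. -/
theorem card_pairsAcross_add_le (i : Fin d) :
    (pairsAcross d (i + 1)).card + (pairsBelowAt i).card ≤ 2 * maxBag d := by
  rw [← Finset.card_union_of_disjoint]
  · refine (Finset.card_le_card ?_).trans (card_pairsAround_le i)
    rintro ⟨u, v⟩ h
    simp only [pairsAround, pairsAcross, pairsBelowAt, Finset.mem_filter, Finset.mem_univ,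
      true_and, Finset.mem_union, Fin.ext_iff, ne_eq] at h ⊢
    lia
  · rw [Finset.disjoint_left]
    rintro ⟨u, v⟩ h
    simp only [pairsAcross, pairsBelowAt, Finset.mem_filter, Finset.mem_univ, true_and,
      Fin.ext_iff, not_or, not_and] at h ⊢
    lia

theorem pairsBelow_succ (i : Fin d) :
    pairsBelow d (i + 1) = pairsBelowAt i ∪ ({(i, i)} ∪ pairsBelow d i) := by
  ext ⟨u, v⟩
  simp only [pairsBelow, pairsBelowAt, Finset.mem_filter, Finset.mem_univ, true_and,
    Finset.mem_union, Finset.mem_singleton, Prod.mk.injEq, Fin.ext_iff]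
  lia

end Pairs

/-! ### Variable elimination along the order of the modes -/

section Elimination

variable {F X : Type*} [Field F] {S : Set (MvPolynomial X F)} {d : ℕ} {I : Fin d → Type*}
  [∀ c, Fintype (I c)]

/-- The sum of the product of the factors of the modes before `i` over all values of the pairs of
such modes. -/
def eliminated (W : Fin d → (∀ p : Fin d × Fin d, I p.1) → MvPolynomial X F) (i : ℕ) :
    (∀ p : Fin d × Fin d, I p.1) → MvPolynomial X F :=
  marginal (pairsBelow d i) fun f => ∏ j with j.1 < i, W j f

variable {W : Fin d → (∀ p : Fin d × Fin d, I p.1) → MvPolynomial X F}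

/-- A factor before `i` sees only pairs meeting the modes before `i`. Those inside are summed out,
so only the crossing ones remain. -/
theorem dependsOn_eliminated (hW : ∀ j, DependsOn (W j) {p | p.1 = j ∨ p.2 = j}) (i : ℕ) :
    DependsOn (eliminated W i) (pairsAcross d i) := by
  refine dependsOn_marginal (u := {p | p.1.1 < i ∨ p.2.1 < i}) ?_ ?_
  · intro f f' hf
    refine Finset.prod_congr rfl fun j hj => hW j fun p hp => hf p ?_
    simp only [Finset.mem_filter, Finset.mem_univ, true_and] at hj
    rcases hp with rfl | rfl
    · exact Or.inl hj
    · exact Or.inr hj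
  · rintro ⟨u, v⟩ h
    simp [pairsAcross, pairsBelow] at h ⊢
    lia

theorem eliminated_zero (f : ∀ p : Fin d × Fin d, I p.1) : eliminated W 0 f = 1 := by
  have h : pairsBelow d 0 = ∅ := by simp [pairsBelow]
  rw [eliminated, h]
  simp [marginal]

theorem eliminated_self (f : ∀ p : Fin d × Fin d, I p.1) :
    eliminated W d f = ∑ f', ∏ j, W j f' := by
  have h : pairsBelow d d = Finset.univ := by simp [pairsBelow]
  simp [eliminated, h, marginal_univ]

/-- The recursion of the elimination: `W i` does not see the pairs below `i`, and the earlier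
factors do not see the loop `(i, i)`, so both inner sums factor out. -/
theorem eliminated_succ (hW : ∀ j, DependsOn (W j) {p | p.1 = j ∨ p.2 = j}) (i : Fin d) :
    eliminated W (i + 1) = marginal (pairsBelowAt i) fun f =>
      marginal {(i, i)} (W i) f * eliminated W i f := by
  have h1 : Disjoint {(i, i)} (pairsBelow d i) := by simp [pairsBelow]
  have h2 : Disjoint (pairsBelowAt i) ({(i, i)} ∪ pairsBelow d i) := by
    rw [Finset.disjoint_left]
    rintro ⟨u, v⟩ h
    simp only [pairsBelow, pairsBelowAt, Finset.mem_filter, Finset.mem_univ, true_and, Finset.mem_union,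
      Finset.mem_singleton, Prod.mk.injEq, Fin.ext_iff, not_or, not_and] at h ⊢
    lia
  have h3 : ∀ f, ∏ j with j.1 < i.1 + 1, W j f = (∏ j with j.1 < i.1, W j f) * W i f := by
    intro f
    have : (Finset.univ.filter fun j : Fin d => j.1 < i.1 + 1) =
        insert i (Finset.univ.filter fun j : Fin d => j.1 < i.1) := by
      ext j; simp [Fin.ext_iff]; lia
    rw [this, Finset.prod_insert (by simp), mul_comm]
  rw [eliminated, pairsBelow_succ, marginal_union h2, marginal_union h1]
  simp only [h3]
  rw [marginal_mul_of_dependsOn (hW i) (by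
    rintro ⟨u, v⟩ h
    simp [pairsBelow, Fin.ext_iff] at h ⊢
    lia)]
  rw [← marginal_mul_of_dependsOn (dependsOn_eliminated hW i) (by simp [pairsAcross])]
  simp only [eliminated, mul_comm]

/-- Evaluation of a sum of products of one factor for each mode by eliminating the pairs of modes
in the order of the modes. -/
theorem derives_sum_prod [∀ c, Nonempty (I c)] {M : ℕ} (hM : ∀ c, Fintype.card (I c) ≤ M) (h1 : 1 ∈ S)
    (κ : Fin d → (∀ p : Fin d × Fin d, I p.1) → F)
    (x : Fin d → (∀ p : Fin d × Fin d, I p.1) → MvPolynomial X F)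
    (hx : ∀ j, Set.range (x j) ⊆ S)
    (hW : ∀ j, DependsOn (fun f => MvPolynomial.C (κ j f) * x j f) {p | p.1 = j ∨ p.2 = j}) :
    Derives S {∑ f, ∏ j, (MvPolynomial.C (κ j f) * x j f)}
      (d * (M ^ (2 * (d - 1) + 1) + 4 * M ^ (2 * maxBag d))) := by
  rcases Nat.eq_zero_or_pos d with rfl | hd
  · refine (derives_of_subset ?_).mono subset_rfl subset_rfl (Nat.zero_le _)
    simpa using h1
  have hM0 : 0 < M := lt_of_lt_of_le Fintype.card_pos (hM ⟨0, hd⟩)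
  have hM' : ∀ p : Fin d × Fin d, Fintype.card (I p.1) ≤ M := fun p => hM p.1
  set W : Fin d → (∀ p : Fin d × Fin d, I p.1) → MvPolynomial X F :=
    fun j f => MvPolynomial.C (κ j f) * x j f with hWdef
  have key : ∀ i ≤ d, Derives S (Set.range (eliminated W i))
      (i * (M ^ (2 * (d - 1) + 1) + 4 * M ^ (2 * maxBag d))) := by
    intro i
    induction i with
    | zero =>
      intro _
      refine (derives_of_subset ?_).mono subset_rfl subset_rfl (Nat.zero_le _)
      rintro _ ⟨f, rfl⟩
      rwa [eliminated_zero]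
    | succ i ih =>
      intro hi
      let j : Fin d := ⟨i, hi⟩
      have hY : DependsOn (marginal {(j, j)} (W j)) (pairsAt j) := by
        refine dependsOn_marginal (hW j) ?_
        rintro ⟨u, v⟩ h
        simp [pairsAt] at h ⊢
        grind
      have hA := dependsOn_eliminated hW i
      have hYA : DependsOn (fun f => marginal {(j, j)} (W j) f * eliminated W i f)
          (pairsAround j) := by
        intro f f' hf
        refine congrArg₂ (· * ·) (hY fun p hp => hf p ?_) (hA fun p hp => hf p ?_)
        · simp only [pairsAt, pairsAround, Finset.coe_filter, Set.mem_ofPred_eq, Finset.mem_univ,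
            true_and, ne_eq, Fin.ext_iff] at hp ⊢
          lia
        · simp only [pairsAcross, pairsAround, Finset.coe_filter, Set.mem_ofPred_eq,
            Finset.mem_univ, true_and, ne_eq, Fin.ext_iff, j] at hp ⊢
          lia
      -- One round: the previous table, the loop summed out of `W j`, the product over the bag of
      -- `j`, and the sum over pairs of `j` with earlier modes. The product costs `3` and the last
      -- sum `1` times `M ^ (2 * maxBag d)`, whence the constant `4`.
      have e1 := ih (by lia)
      have e2 := derives_range_marginal (S := S ∪ Set.range (eliminated W i)) hM' (κ j)
        (g := x j) ((hx j).trans Set.subset_union_left) hY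
      have e3 := derives_range_mul (S := S ∪ (Set.range (eliminated W i) ∪
        Set.range (marginal {(j, j)} (W j)))) hM'
        (Set.subset_union_of_subset_right Set.subset_union_right _)
        (Set.subset_union_of_subset_right Set.subset_union_left _) hYA
      have e4 := derives_range_marginal (S := S ∪ ((Set.range (eliminated W i) ∪
        Set.range (marginal {(j, j)} (W j))) ∪
        Set.range fun f => marginal {(j, j)} (W j) f * eliminated W i f)) hM'
        (s := pairsBelowAt j) (t := pairsAcross d (i + 1)) (fun _ => 1)
        (g := fun f => marginal {(j, j)} (W j) f * eliminated W i f)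
        (Set.subset_union_of_subset_right Set.subset_union_right _) (by
          simp only [map_one, one_mul]
          rw [← eliminated_succ hW j]
          exact dependsOn_eliminated hW _)
      simp only [map_one, one_mul] at e4
      rw [← eliminated_succ hW j] at e4
      refine (((e1.trans e2).trans e3).trans e4).mono subset_rfl Set.subset_union_right ?_
      have c2 : M ^ (pairsAt j).card * M ^ ({(j, j)} : Finset (Fin d × Fin d)).card ≤
          M ^ (2 * (d - 1) + 1) := by
        rw [← pow_add]
        exact Nat.pow_le_pow_right hM0 (by simpa using card_pairsAt_le j)
      have c3 : M ^ (pairsAround j).card ≤ M ^ (2 * maxBag d) :=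
        Nat.pow_le_pow_right hM0 (card_pairsAround_le j)
      have c4 : M ^ (pairsAcross d (i + 1)).card * M ^ (pairsBelowAt j).card ≤
          M ^ (2 * maxBag d) := by
        rw [← pow_add]
        exact Nat.pow_le_pow_right hM0 (card_pairsAcross_add_le j)
      rw [Nat.succ_mul]
      lia
  refine (key d le_rfl).mono subset_rfl ?_ le_rfl
  rw [Set.singleton_subset_iff]
  exact ⟨fun p => Classical.arbitrary _, eliminated_self _⟩

end Elimination

namespace SimpleGraph

/-! ### Directions in trees -/

section Direction

variable {N : Type*} {G : SimpleGraph N}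

/-- The first vertex after `a` on the path from `a` to `c` in a tree. -/
def IsTree.direction (hG : G.IsTree) (a c : N) : N := (hG.existsUnique_path a c).choose.snd

theorem IsTree.direction_eq_snd (hG : G.IsTree) {a c : N} {p : G.Walk a c} (hp : p.IsPath) :
    hG.direction a c = p.snd := by
  rw [direction, (hG.existsUnique_path a c).unique (hG.existsUnique_path a c).choose_spec.1 hp]

theorem IsTree.adj_direction (hG : G.IsTree) {a c : N} (h : a ≠ c) :
    G.Adj a (hG.direction a c) :=
  Walk.adj_snd (Walk.not_nil_of_ne h)

/-- Of the paths from `a` to two adjacent vertices of a tree, one is an initial segment of the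
other. -/
theorem IsTree.direction_eq_of_adj (hG : G.IsTree) {a c c' : N} (hc : c ≠ a) (hc' : c' ≠ a)
    (h : G.Adj c c') : hG.direction a c = hG.direction a c' := by
  classical
  obtain ⟨p, hp, -⟩ := hG.existsUnique_path a c
  obtain ⟨q, hq, -⟩ := hG.existsUnique_path a c'
  by_cases hcq : c ∈ q.support
  · rw [hG.direction_eq_snd hq, hG.direction_eq_snd (hq.takeUntil hcq), Walk.snd_takeUntil hc]
  · have := hG.isAcyclic.mem_support_of_ne_mem_support_of_adj_of_isPath hp hq h hcq
    rw [hG.direction_eq_snd hp, hG.direction_eq_snd (hp.takeUntil this), Walk.snd_takeUntil hc']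

theorem IsTree.direction_eq_of_walk (hG : G.IsTree) {a c c' : N} (q : G.Walk c c')
    (ha : a ∉ q.support) : hG.direction a c = hG.direction a c' := by
  induction q with
  | nil => rfl
  | cons h q ih =>
    rw [Walk.support_cons, List.mem_cons, not_or] at ha
    rw [← ih ha.2]
    exact hG.direction_eq_of_adj (Ne.symm ha.1)
      (fun h => ha.2 (h ▸ q.start_mem_support)) h

/-- Otherwise `b` would lie on the path from `a` to `c` and `a` on the path from `b` to `c`, which a
tree forbids for adjacent vertices. -/
theorem IsTree.direction_ne_of_direction_eq (hG : G.IsTree) {a b c : N} (hab : G.Adj a b)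
    (h : hG.direction a c = b) : hG.direction b c ≠ a := by
  intro h'
  obtain ⟨p, hp, -⟩ := hG.existsUnique_path a c
  obtain ⟨q, hq, -⟩ := hG.existsUnique_path b c
  rw [hG.direction_eq_snd hp] at h
  rw [hG.direction_eq_snd hq] at h'
  refine hG.isAcyclic.ne_mem_support_of_support_of_adj_of_isPath hp.reverse hq.reverse hab ?_ ?_
  · rw [Walk.support_reverse, List.mem_reverse, ← h]
    exact Walk.getVert_mem_support _ _
  · rw [Walk.support_reverse, List.mem_reverse, ← h']
    exact Walk.getVert_mem_support _ _

/-- Every assignment of a neighbour to each vertex of a finite tree reverses some edge. -/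
theorem IsTree.exists_map_map_eq [Fintype N] (hG : G.IsTree) (b : N → N)
    (hb : ∀ a, G.Adj a (b a)) : ∃ a, b (b a) = a := by
  classical
  have hcard : G.edgeFinset.card < (Finset.univ : Finset N).card := by
    have := hG.card_edgeFinset
    rw [Finset.card_univ]
    lia
  obtain ⟨a, -, a', -, hne, h⟩ := Finset.exists_ne_map_eq_of_card_lt_of_maps_to hcard
    (f := fun a => s(a, b a)) (fun a _ => by simpa using hb a)
  rw [Sym2.eq_iff] at h
  rcases h with h | h
  · exact absurd h.1 hne
  · exact ⟨a, by rw [h.2, ← h.1]⟩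

end Direction

/-! ### Pairs in different parts of a partition -/

section Partition

/-- Convexity: with parts at most `m`, the sum of squares is largest when one part is full and one
holds the rest. The first clause serves the induction while the total is still at most `m`. -/
theorem sum_sq_le {κ : Type*} (t : Finset κ) (s : κ → ℕ) (m : ℕ) (hs : ∀ k ∈ t, s k ≤ m) :
    (∑ k ∈ t, s k ≤ m → ∑ k ∈ t, s k ^ 2 ≤ (∑ k ∈ t, s k) ^ 2) ∧
    ∀ r ≤ m, ∑ k ∈ t, s k = m + r → ∑ k ∈ t, s k ^ 2 ≤ m ^ 2 + r ^ 2 := by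
  classical
  induction t using Finset.induction_on with
  | empty => simp
  | insert k t hk ih =>
    obtain ⟨ih1, ih2⟩ := ih fun j hj => hs j (Finset.mem_insert_of_mem hj)
    have hy := hs k (Finset.mem_insert_self _ _)
    rw [Finset.sum_insert hk, Finset.sum_insert hk]
    generalize ∑ k ∈ t, s k = x at *
    generalize ∑ k ∈ t, s k ^ 2 = z at *
    generalize s k = y at *
    refine ⟨fun h => ?_, fun r hr h => ?_⟩
    · have := ih1 (by lia)
      nlinarith
    · rcases le_or_gt x m with hx | hx
      · have := ih1 hx
        zify at *
        nlinarith [mul_nonneg (sub_nonneg.2 hx) (sub_nonneg.2 hy)]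
      · obtain ⟨r', rfl⟩ := Nat.exists_eq_add_of_lt hx
        have := ih2 (r' + 1) (by lia) (by lia)
        have hr' : r = r' + 1 + y := by lia
        subst hr'
        nlinarith

variable {d : ℕ} {κ : Type*} [Fintype κ] [DecidableEq κ]

/-- If no class is large, at least `2 * maxBag d` ordered pairs cross between classes. The term for
`v₀` breaks the tie between two halves for even `d`. -/
theorem two_mul_maxBag_add_sum_sq_le (f : Fin d → κ) (v₀ : Fin d)
    (h : ∀ k, 2 * (Finset.univ.filter fun v => f v = k).card + (if f v₀ = k then 1 else 0) ≤ d) :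
    2 * maxBag d + ∑ k, (Finset.univ.filter fun v => f v = k).card ^ 2 ≤ d ^ 2 := by
  set s : κ → ℕ := fun k => (Finset.univ.filter fun v => f v = k).card with hs
  have hsum : ∑ k, s k = d := by
    rw [← Finset.card_eq_sum_card_fiberwise (fun v _ => Finset.mem_univ (f v))]
    simp
  have h0 : 2 * s (f v₀) + 1 ≤ d := by simpa using h (f v₀)
  have h1 : 1 ≤ s (f v₀) := Finset.card_pos.2 ⟨v₀, by simp⟩
  have hm : ∀ k ∈ Finset.univ.erase (f v₀), s k ≤ d / 2 := fun k _ => by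
    have := h k
    change 2 * s k + _ ≤ d at this
    lia
  change 2 * maxBag d + ∑ k, s k ^ 2 ≤ d ^ 2
  rw [← Finset.add_sum_erase _ _ (Finset.mem_univ (f v₀))] at hsum ⊢
  -- The extremal partition has parts `d / 2`, `a + 1` (the class of `v₀`) and `b + 1`. The last is
  -- nonempty because the class of `v₀` is strictly below half, and `(a + 1) * (b + 1) ≥ a + b + 1`
  -- finishes the estimate.
  obtain ⟨a, ha⟩ : ∃ a, s (f v₀) = a + 1 := ⟨s (f v₀) - 1, by lia⟩
  obtain ⟨b, hb⟩ : ∃ b, (d + 1) / 2 = a + 1 + (b + 1) := ⟨(d + 1) / 2 - (a + 1) - 1, by lia⟩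
  have h2 := (sum_sq_le _ s (d / 2) hm).2 (b + 1) (by lia) (by lia)
  have hd : d / 2 + (a + 1 + (b + 1)) = d := by lia
  rw [maxBag, hb, ha]
  generalize d / 2 = m at *
  have h3 : 1 ≤ (m + 1) * (a + 1 + (b + 1)) := by nlinarith
  rw [← hd]
  have h4 : 2 * ((m + 1) * (a + 1 + (b + 1)) - 1) = 2 * ((m + 1) * (a + 1 + (b + 1))) - 2 := by
    lia
  rw [h4]
  have h5 : 2 * ((m + 1) * (a + 1 + (b + 1))) + ((a + 1) ^ 2 + (m ^ 2 + (b + 1) ^ 2)) ≤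
      (m + (a + 1 + (b + 1))) ^ 2 + 2 := by nlinarith [Nat.zero_le (a * b)]
  have h6 : 2 ≤ 2 * ((m + 1) * (a + 1 + (b + 1))) := by lia
  lia

theorem card_ne_add_sum_sq (f : Fin d → κ) :
    (Finset.univ.filter fun p : Fin d × Fin d => f p.1 ≠ f p.2).card +
      ∑ k, (Finset.univ.filter fun v => f v = k).card ^ 2 = d ^ 2 := by
  have h1 : ∑ k, (Finset.univ.filter fun v => f v = k).card ^ 2 =
      (Finset.univ.filter fun p : Fin d × Fin d => f p.1 = f p.2).card := by
    rw [Finset.card_eq_sum_card_fiberwise (t := Finset.univ) (f := fun p => f p.1)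
      (fun v _ => Finset.mem_univ _)]
    refine Finset.sum_congr rfl fun k _ => ?_
    rw [sq, ← Finset.card_product]
    congr 1
    ext p
    simp only [Finset.mem_product, Finset.mem_filter, Finset.mem_univ, true_and]
    exact ⟨fun h => ⟨h.1.trans h.2.symm, h.1⟩, fun h => ⟨h.2, h.1.symm.trans h.2⟩⟩
  rw [h1, add_comm, Finset.card_filter_add_card_filter_not]
  simp [sq]

end Partition

/-! ### The treewidth of the line graph of a complete graph -/

section CompleteGraph

variable {d : ℕ}

/-- The graph with those edges of the complete graph that are not in `H`. -/
def edgesOff (H : Finset (⊤ : SimpleGraph (Fin d)).edgeSet) : SimpleGraph (Fin d) where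
  Adj u v := u ≠ v ∧ ∀ e ∈ H, e.1 ≠ s(u, v)
  symm.symm u v h := ⟨h.1.symm, fun e he => by rw [Sym2.eq_swap]; exact h.2 e he⟩
  loopless.irrefl u h := h.1 rfl

/-- Any edge between different classes must have been deleted, and each edge of `H` accounts for at
most two ordered pairs. -/
theorem two_mul_card_crossing_le {κ : Type*} [DecidableEq κ]
    (H : Finset (⊤ : SimpleGraph (Fin d)).edgeSet) (f : Fin d → κ)
    (hf : ∀ u v, (edgesOff H).Adj u v → f u = f v) :
    (Finset.univ.filter fun p : Fin d × Fin d => f p.1 ≠ f p.2).card ≤ 2 * H.card := by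
  rw [← Finset.card_map (Function.Embedding.subtype _)]
  refine Finset.card_le_mul_card_image_of_maps_to (f := fun p => s(p.1, p.2)) ?_ 2 ?_
  · rintro ⟨u, v⟩ h
    simp only [Finset.mem_filter, Finset.mem_univ, true_and] at h
    have hn : ¬ (edgesOff H).Adj u v := fun h' => h (hf u v h')
    simp only [edgesOff, not_and, not_forall, not_not] at hn
    obtain ⟨e, he, h'⟩ := hn fun h' => h (congrArg f h')
    exact Finset.mem_map.2 ⟨e, he, h'⟩
  · intro e _
    induction e with
    | _ u v =>
      refine (Finset.card_le_card (t := {(u, v), (v, u)}) ?_).trans Finset.card_le_two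
      rintro ⟨a, b⟩ h
      simp only [Finset.mem_filter, Sym2.eq_iff] at h
      simpa using h.2

open Classical in
theorem exists_large_component (v₀ : Fin d) (H : Finset (⊤ : SimpleGraph (Fin d)).edgeSet)
    (hH : H.card < maxBag d) : ∃ C : (edgesOff H).ConnectedComponent,
      d < 2 * (Finset.univ.filter fun v => (edgesOff H).connectedComponentMk v = C).card +
        if (edgesOff H).connectedComponentMk v₀ = C then 1 else 0 := by
  by_contra! h
  have h1 := two_mul_maxBag_add_sum_sq_le _ v₀ h
  have h2 := card_ne_add_sum_sq (edgesOff H).connectedComponentMk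
  have h3 := two_mul_card_crossing_le H (edgesOff H).connectedComponentMk
    fun u v h => ConnectedComponent.connectedComponentMk_eq_of_adj h
  lia

variable (D : (⊤ : SimpleGraph (Fin d)).lineGraph.TreeDecomposition)

theorem exists_common_node {e e' : (⊤ : SimpleGraph (Fin d)).edgeSet} {u : Fin d} (he : u ∈ e.1)
    (he' : u ∈ e'.1) : ∃ c, e ∈ D.bag c ∧ e' ∈ D.bag c := by
  by_cases h : e = e'
  · obtain ⟨c, hc⟩ := D.exists_mem_bag e
    exact ⟨c, hc, h ▸ hc⟩
  · exact D.exists_edge_bag _ _ (lineGraph_adj_iff_exists.2 ⟨h, u, he, he'⟩)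

theorem direction_eq_of_mem_bag {e : (⊤ : SimpleGraph (Fin d)).edgeSet} {a c c' : D.Node}
    (ha : e ∉ D.bag a) (hc : e ∈ D.bag c) (hc' : e ∈ D.bag c') :
    D.isTree.direction a c = D.isTree.direction a c' := by
  obtain ⟨p, hp, -⟩ := D.isTree.existsUnique_path c c'
  exact D.isTree.direction_eq_of_walk p fun h => ha (D.mem_bag_of_path c c' p hp a h e hc hc')

/-- Consecutive edges of a walk share a vertex and hence a bag, and none of them lies in the bag of
`a`. Their subtrees thus stay on one side of `a`. -/
theorem direction_eq_of_walk_edgesOff {a : D.Node} {u u' : Fin d}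
    (q : (edgesOff (D.bag a)).Walk u u') : ∀ {e e' : (⊤ : SimpleGraph (Fin d)).edgeSet}
    {c c' : D.Node}, u ∈ e.1 → u' ∈ e'.1 → e ∉ D.bag a → e' ∉ D.bag a → e ∈ D.bag c →
    e' ∈ D.bag c' → D.isTree.direction a c = D.isTree.direction a c' := by
  induction q with
  | nil =>
    intro e e' c c' he he' hea hea' hc hc'
    obtain ⟨c₁, h1, h2⟩ := exists_common_node D he he'
    rw [direction_eq_of_mem_bag D hea hc h1, direction_eq_of_mem_bag D hea' h2 hc']
  | @cons u w u' h q ih =>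
    intro e e' c c' he he' hea hea' hc hc'
    let g : (⊤ : SimpleGraph (Fin d)).edgeSet := ⟨s(u, w), h.1⟩
    have hg : g ∉ D.bag a := fun hg => h.2 g hg rfl
    obtain ⟨c₁, h1, h2⟩ := exists_common_node D (e' := g) he (Sym2.mem_mk_left u w)
    rw [direction_eq_of_mem_bag D hea hc h1]
    exact ih (Sym2.mem_mk_right u w) he' hg hea' h2 hc'

theorem exists_adj_of_two_le_card {V : Type*} [Fintype V] {G : SimpleGraph V}
    [DecidableEq G.ConnectedComponent] {C : G.ConnectedComponent}
    (hC : 2 ≤ (Finset.univ.filter fun v => G.connectedComponentMk v = C).card) {u : V}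
    (hu : G.connectedComponentMk u = C) : ∃ w, G.Adj u w := by
  obtain ⟨w, hw, hne⟩ := Finset.exists_mem_ne (lt_of_lt_of_le one_lt_two hC) u
  simp only [Finset.mem_filter, Finset.mem_univ, true_and] at hw
  obtain ⟨p⟩ := ConnectedComponent.exact (hu.trans hw.symm)
  exact ⟨_, p.adj_snd (Walk.not_nil_of_ne hne.symm)⟩

/-- The large component left at each node points to a neighbouring node. Some edge is pointed along
from both ends, and a vertex common to the two components gives a contradiction. -/
theorem maxBag_le_sup_card (hd : 1 ≤ d) :
    maxBag d ≤ Finset.univ.sup fun a => (D.bag a).card := by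
  classical
  by_contra! hlt
  have hlt' : ∀ a, (D.bag a).card < maxBag d := fun a =>
    (Finset.le_sup (f := fun a => (D.bag a).card) (Finset.mem_univ a)).trans_lt hlt
  rcases (show d = 1 ∨ d = 2 ∨ 3 ≤ d by lia) with rfl | rfl | h3
  · simp [maxBag] at hlt
  · obtain ⟨a, ha⟩ := D.exists_mem_bag ⟨s(0, 1), by simp⟩
    have h1 := hlt' a
    have h2 : 0 < (D.bag a).card := Finset.card_pos.2 ⟨_, ha⟩
    have h3 : maxBag 2 = 1 := rfl
    lia
  let v₀ : Fin d := ⟨0, hd⟩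
  choose C hC using fun a => exists_large_component v₀ (D.bag a) (hlt' a)
  -- Here `3 ≤ d` is needed. A component with two vertices has, at each vertex, an edge outside the
  -- bag, so that it determines a direction.
  have hC2 : ∀ a, 2 ≤ (Finset.univ.filter fun v =>
      (edgesOff (D.bag a)).connectedComponentMk v = C a).card := fun a => by
    have := hC a
    split_ifs at this <;> lia
  have hedge : ∀ a u, (edgesOff (D.bag a)).connectedComponentMk u = C a →
      ∃ e : (⊤ : SimpleGraph (Fin d)).edgeSet, u ∈ e.1 ∧ e ∉ D.bag a := by
    intro a u hu
    obtain ⟨w, hw⟩ := exists_adj_of_two_le_card (hC2 a) hu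
    exact ⟨⟨s(u, w), hw.1⟩, Sym2.mem_mk_left u w, fun h => hw.2 _ h rfl⟩
  have hdir : ∀ a, ∃ b, D.tree.Adj a b ∧ ∀ u, (edgesOff (D.bag a)).connectedComponentMk u = C a →
      ∀ e : (⊤ : SimpleGraph (Fin d)).edgeSet, u ∈ e.1 → e ∉ D.bag a → ∀ c, e ∈ D.bag c →
      D.isTree.direction a c = b := by
    intro a
    obtain ⟨u, hu⟩ := (C a).exists_rep
    obtain ⟨e, hue, he⟩ := hedge a u hu
    obtain ⟨c, hc⟩ := D.exists_mem_bag e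
    refine ⟨D.isTree.direction a c, D.isTree.adj_direction fun h => he (h ▸ hc), ?_⟩
    intro u' hu' e' hue' he' c' hc'
    obtain ⟨q⟩ := ConnectedComponent.exact (hu'.trans hu.symm)
    exact direction_eq_of_walk_edgesOff D q hue' hue he' he hc' hc
  choose b hb hbC using hdir
  obtain ⟨a, ha⟩ := D.isTree.exists_map_map_eq b hb
  obtain ⟨u, hu, hu'⟩ : ∃ u, (edgesOff (D.bag a)).connectedComponentMk u = C a ∧
      (edgesOff (D.bag (b a))).connectedComponentMk u = C (b a) := by
    -- Disjoint components would count `v₀` at most once, so twice their total size plus `1` would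
    -- be at least `2 * d + 2`, too many vertices.
    by_contra! h
    have h1 := hC a
    have h2 := hC (b a)
    have h4 : Disjoint
        (Finset.univ.filter fun v => (edgesOff (D.bag a)).connectedComponentMk v = C a)
        (Finset.univ.filter fun v =>
          (edgesOff (D.bag (b a))).connectedComponentMk v = C (b a)) := by
      rw [Finset.disjoint_filter]
      exact fun v _ => h v
    have h5 := Finset.card_union_of_disjoint h4
    have h6 := Finset.card_le_univ (Finset.univ.filter (fun v =>
      (edgesOff (D.bag a)).connectedComponentMk v = C a) ∪ Finset.univ.filter fun v =>
          (edgesOff (D.bag (b a))).connectedComponentMk v = C (b a))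
    rw [Fintype.card_fin] at h6
    have h7 := h v₀
    split_ifs at h1 h2 with h8 h9 h9
    · exact h7 h8 h9
    all_goals lia
  obtain ⟨e, hue, he⟩ := hedge a u hu
  obtain ⟨e', hue', he'⟩ := hedge (b a) u hu'
  obtain ⟨c, hc, hc'⟩ := exists_common_node D hue hue'
  have h1 := hbC a u hu e hue he c hc
  have h2 := hbC (b a) u hu' e' hue' he' c hc'
  rw [ha] at h2
  exact D.isTree.direction_ne_of_direction_eq (hb a) h1 h2

/-! ### The canonical path decomposition -/

theorem pathGraph_isTree (m : ℕ) : (pathGraph (m + 1)).IsTree := by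
  refine isTree_iff_connected_and_card.2 ⟨pathGraph_connected m, le_antisymm ?_
    (pathGraph_connected m).card_vert_le_card_edgeSet_add_one⟩
  have h : (pathGraph (m + 1)).edgeSet ⊆
      Set.range fun i : Fin m => s(i.castSucc, i.succ) := by
    intro e
    induction e with
    | _ u v =>
      intro h
      rw [mem_edgeSet, pathGraph_adj] at h
      rcases h with h | h
      · exact ⟨⟨u, by lia⟩, by simp [h]⟩
      · exact ⟨⟨v, by lia⟩, by simp [h, Sym2.eq_swap]⟩
  have h1 := Nat.card_mono (Set.finite_range _) h
  have h2 := Finite.card_range_le fun i : Fin m => s(i.castSucc, i.succ)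
  simp only [Nat.card_eq_fintype_card, Fintype.card_fin] at *
  lia

theorem exists_walk_pathGraph {n : ℕ} (k : ℕ) : ∀ a c : Fin n, c.1 = a.1 + k →
    ∃ p : (pathGraph n).Walk a c, ∀ b ∈ p.support, a ≤ b ∧ b ≤ c := by
  induction k with
  | zero =>
    intro a c h
    obtain rfl : c = a := Fin.ext h
    exact ⟨.nil, by simp⟩
  | succ k ih =>
    intro a c h
    obtain ⟨p, hp⟩ := ih ⟨a + 1, by lia⟩ c (by simp; lia)
    refine ⟨.cons (pathGraph_adj.2 (Or.inl rfl)) p, ?_⟩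
    intro b hb
    rw [Walk.support_cons, List.mem_cons] at hb
    rcases hb with rfl | hb
    · exact ⟨le_rfl, by rw [Fin.le_def]; lia⟩
    · have := hp b hb
      rw [Fin.le_def] at this ⊢
      exact ⟨by simp at this; lia, this.2⟩

theorem mem_support_pathGraph {m : ℕ} {a c b : Fin (m + 1)} {p : (pathGraph (m + 1)).Walk a c}
    (hp : p.IsPath) (hb : b ∈ p.support) : (a ≤ b ∧ b ≤ c) ∨ (c ≤ b ∧ b ≤ a) := by
  have key : ∀ {a c : Fin (m + 1)} {p : (pathGraph (m + 1)).Walk a c}, p.IsPath → b ∈ p.support →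
      a ≤ c → a ≤ b ∧ b ≤ c := by
    intro a c p hp hb h
    obtain ⟨q, hq⟩ := exists_walk_pathGraph (c.1 - a.1) a c (by rw [Fin.le_def] at h; lia)
    rw [((pathGraph_isTree m).existsUnique_path a c).unique hp q.bypass_isPath] at hb
    exact hq b (q.support_bypass_subset_support hb)
  rcases le_total a c with h | h
  · exact Or.inl (key hp hb h)
  · exact Or.inr (key hp.reverse (by simpa using hb) h)

open Classical in
/-- The edges of the complete graph that contain `i` or cross from before `i` to after `i`. -/
def edgesAround (i : Fin d) : Finset (⊤ : SimpleGraph (Fin d)).edgeSet :=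
  Finset.univ.filter fun e => ∃ u v, u ≤ i ∧ i ≤ v ∧ e.1 = s(u, v)

theorem mem_edgesAround {i : Fin d} {e : (⊤ : SimpleGraph (Fin d)).edgeSet} :
    e ∈ edgesAround i ↔ ∃ u v, u ≤ i ∧ i ≤ v ∧ e.1 = s(u, v) := by
  simp [edgesAround]

theorem mem_edgesAround_of_mem {i : Fin d} {e : (⊤ : SimpleGraph (Fin d)).edgeSet}
    (h : i ∈ e.1) : e ∈ edgesAround i := by
  obtain ⟨v, hv⟩ := h
  rw [mem_edgesAround]
  rcases le_total i v with h | h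
  · exact ⟨i, v, le_rfl, h, hv⟩
  · exact ⟨v, i, h, le_rfl, hv.trans Sym2.eq_swap⟩

theorem card_edgesAround_le (i : Fin d) : (edgesAround i).card ≤ maxBag d := by
  classical
  rw [← Finset.card_map (Function.Embedding.subtype _)]
  refine (Finset.card_le_card (t := ((Finset.Iic i ×ˢ Finset.Ici i).erase (i, i)).image
    fun p => s(p.1, p.2)) ?_).trans (Finset.card_image_le.trans (card_Iic_product_Ici_erase i))
  intro e he
  obtain ⟨e, he', rfl⟩ := Finset.mem_map.1 he
  obtain ⟨u, v, hu, hv, h⟩ := mem_edgesAround.1 he'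
  refine Finset.mem_image.2 ⟨(u, v), ?_, h.symm⟩
  simp only [Finset.mem_erase, Finset.mem_product, Finset.mem_Iic, Finset.mem_Ici, hu, hv, ne_eq,
    Prod.mk.injEq, and_self, and_true]
  rintro ⟨rfl, rfl⟩
  have := e.2
  rw [h] at this
  simp at this

/-- The canonical path decomposition of the line graph of a complete graph. -/
def pathDecomposition (m : ℕ) : (⊤ : SimpleGraph (Fin (m + 1))).lineGraph.TreeDecomposition where
  Node := Fin (m + 1)
  tree := pathGraph (m + 1)
  isTree := pathGraph_isTree m
  bag := edgesAround
  exists_mem_bag e := by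
    obtain ⟨e, he⟩ := e
    induction e with
    | _ u v => exact ⟨u, mem_edgesAround_of_mem (Sym2.mem_mk_left u v)⟩
  exists_edge_bag e e' h := by
    obtain ⟨-, v, h, h'⟩ := lineGraph_adj_iff_exists.1 h
    exact ⟨v, mem_edgesAround_of_mem h, mem_edgesAround_of_mem h'⟩
  mem_bag_of_path a c p hp b hb e ha hc := by
    rw [mem_edgesAround] at ha hc ⊢
    obtain ⟨u, v, hu, hv, h⟩ := ha
    obtain ⟨u', v', hu', hv', h'⟩ := hc
    have h2 := h.symm.trans h'
    rw [Sym2.eq_iff] at h2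
    have h3 := mem_support_pathGraph hp hb
    rcases h2 with ⟨rfl, rfl⟩ | ⟨rfl, rfl⟩
    · refine ⟨u, v, ?_, ?_, h⟩ <;> lia
    · refine ⟨u, v, ?_, ?_, h⟩ <;> lia

theorem lineTreewidth_top (hd : 1 ≤ d) :
    (⊤ : SimpleGraph (Fin d)).lineTreewidth = (maxBag d : ℤ) - 1 := by
  obtain ⟨m, rfl⟩ : ∃ m, d = m + 1 := ⟨d - 1, by lia⟩
  have hle : ∀ D : (⊤ : SimpleGraph (Fin (m + 1))).lineGraph.TreeDecomposition,
      (maxBag (m + 1) : ℤ) - 1 ≤ D.width := fun D =>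
    sub_le_sub_right (Nat.cast_le.2 (maxBag_le_sup_card D hd)) 1
  refine IsLeast.csInf_eq ⟨⟨pathDecomposition m, le_antisymm ?_ (hle _)⟩, ?_⟩
  · exact sub_le_sub_right (Nat.cast_le.2 (Finset.sup_le fun i _ => card_edgesAround_le i)) 1
  · rintro _ ⟨D, rfl⟩
    exact hle D

end CompleteGraph

end SimpleGraph

/-! ### Circuits for Kronecker powers and bounds on exponents -/

/-- Multiplication of a vector of polynomials by a Kronecker power of a matrix, one factor at a
time. -/
theorem derives_kronPow_mulVec {F X : Type*} [Field F] {S : Set (MvPolynomial X F)} {n : ℕ}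
    (hn : 1 ≤ n) (m : Fin n → Fin n → F) (k : ℕ) :
    ∀ x : (Fin k → Fin n) → MvPolynomial X F, Set.range x ⊆ S →
      Derives S (Set.range fun b : Fin k → Fin n =>
        ∑ a : Fin k → Fin n, MvPolynomial.C (∏ l, m (a l) (b l)) * x a) (k * n ^ (k + 1)) := by
  induction k with
  | zero =>
    intro x hx
    refine (derives_of_subset ?_).mono subset_rfl subset_rfl (Nat.zero_le _)
    rintro _ ⟨b, rfl⟩
    simpa using hx ⟨_, rfl⟩
  | succ k ih =>
    intro x hx
    set P : Fin n → Set (MvPolynomial X F) := fun c => Set.range fun b : Fin k → Fin n =>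
        ∑ a : Fin k → Fin n, MvPolynomial.C (∏ l, m (a l) (b l)) * x (Fin.cons c a) with hP
    -- Fixing the first coordinate gives `n` instances for `k`. Combining them takes `n ^ (k + 1)`
    -- sums of `n` terms, so each factor costs `n ^ (k + 2)`.
    have h1 : Derives S (⋃ c ∈ (Finset.univ : Finset (Fin n)), P c) (n * (k * n ^ (k + 1))) := by
      have := Derives.biUnion (S := S) (Finset.univ : Finset (Fin n)) (P := P) fun c _ =>
        ih (fun a => x (Fin.cons c a)) (by rintro _ ⟨a, rfl⟩; exact hx ⟨_, rfl⟩)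
      rwa [Finset.card_univ, Fintype.card_fin] at this
    have h2 : ∀ b : Fin (k + 1) → Fin n,
        ∑ a : Fin (k + 1) → Fin n, MvPolynomial.C (∏ l, m (a l) (b l)) * x a =
          ∑ c : Fin n, MvPolynomial.C (m c (b 0)) * ∑ a : Fin k → Fin n,
            MvPolynomial.C (∏ l, m (a l) (Fin.tail b l)) * x (Fin.cons c a) := by
      intro b
      rw [← (Fin.consEquiv fun _ : Fin (k + 1) => Fin n).sum_comp, Fintype.sum_prod_type]
      refine Finset.sum_congr rfl fun c _ => ?_
      rw [Finset.mul_sum]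
      refine Finset.sum_congr rfl fun a _ => ?_
      simp [Fin.consEquiv, Fin.prod_univ_succ, Fin.tail, mul_assoc]
    have h3 := Derives.biUnion (S := S ∪ ⋃ c ∈ (Finset.univ : Finset (Fin n)), P c)
      (Finset.univ : Finset (Fin (k + 1) → Fin n)) (m := n) (P := fun b =>
        {∑ a : Fin (k + 1) → Fin n, MvPolynomial.C (∏ l, m (a l) (b l)) * x a}) (fun b _ => by
      rw [h2 b]
      refine (derives_sum (Finset.univ : Finset (Fin n)) ⟨⟨0, hn⟩, Finset.mem_univ _⟩
        (fun c => m c (b 0)) _ fun c _ => ?_).mono subset_rfl subset_rfl (by simp)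
      exact Or.inr (Set.mem_biUnion (Finset.mem_univ c) ⟨Fin.tail b, rfl⟩))
    refine (h1.trans h3).mono subset_rfl ?_ (le_of_eq ?_)
    · rintro _ ⟨b, rfl⟩
      exact Or.inr (Set.mem_biUnion (Finset.mem_univ b) rfl)
    · simp
      ring

namespace Tensor

variable {F : Type*} [Field F] {d n : ℕ}

/-- The circuit complexity of a Kronecker power of a matrix. -/
theorem circuitComplexity_kronPow_two_le (hn : 1 ≤ n) (T : Tensor F 2 (Fin n)) (k : ℕ) :
    circuitComplexity (T.kronPow k).toPoly ≤ k * n ^ (k + 1) + 4 * n ^ k + 1 := by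
  set S : Set (MvPolynomial (Fin 2 × (Fin k → Fin n)) F) :=
    insert 1 (Set.range MvPolynomial.X) with hS
  have : Nonempty (Fin n) := ⟨⟨0, hn⟩⟩
  set z : (Fin k → Fin n) → MvPolynomial (Fin 2 × (Fin k → Fin n)) F := fun b =>
    ∑ a : Fin k → Fin n, MvPolynomial.C (∏ l, T ![a l, b l]) * MvPolynomial.X (0, a) with hz
  have hcard : (Finset.univ : Finset (Fin k → Fin n)).card = n ^ k := by simp
  have h1 : Derives S (Set.range z) (k * n ^ (k + 1)) :=
    derives_kronPow_mulVec hn (fun a b => T ![a, b]) k (fun a => MvPolynomial.X (0, a)) (by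
      rintro _ ⟨a, rfl⟩
      exact Or.inr ⟨_, rfl⟩)
  have h2 := Derives.biUnion (S := S ∪ Set.range z) (Finset.univ : Finset (Fin k → Fin n))
    (m := 3) (P := fun b => {z b * MvPolynomial.X (1, b)})
    (fun b _ => derives_mul (Or.inr ⟨b, rfl⟩) (Or.inl (Or.inr ⟨_, rfl⟩)))
  have h3 := derives_sum (S := S ∪ (Set.range z ∪ ⋃ b ∈ (Finset.univ : Finset (Fin k → Fin n)),
      {z b * MvPolynomial.X (1, b)})) Finset.univ Finset.univ_nonempty (fun _ => 1)
    (fun b => z b * MvPolynomial.X (1, b))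
    (fun b hb => Or.inr (Or.inr (Set.mem_biUnion hb rfl)))
  have h4 := ((h1.trans h2).trans h3) S 0 subset_rfl hasCircuit_insert_one_range_X
  rw [hcard] at h4
  -- The bilinear form is the matrix applied to the first vector of indeterminates, paired with the
  -- second.
  have h5 : (T.kronPow k).toPoly =
      ∑ b, MvPolynomial.C (1 : F) * (z b * MvPolynomial.X (1, b)) := by
    rw [toPoly, ← (finTwoArrowEquiv (Fin k → Fin n)).symm.sum_comp, Fintype.sum_prod_type_right]
    refine Finset.sum_congr rfl fun b _ => ?_
    rw [map_one, one_mul, hz, Finset.sum_mul]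
    refine Finset.sum_congr rfl fun a _ => ?_
    have h6 : ∀ l, (fun j : Fin 2 => (finTwoArrowEquiv _).symm (a, b) j l) = ![a l, b l] := by
      intro l; funext j; fin_cases j <;> rfl
    simp only [kronPow, h6, mul_assoc, Fin.prod_univ_two]
    rfl
  rw [← h5] at h4
  refine (h4.circuitComplexity_le (Or.inr (Or.inr rfl))).trans (le_of_eq ?_)
  ring

/-- The circuit complexity of a Kronecker power whose factors are distributed evenly over the
modes. -/
theorem circuitComplexity_kronPow_le (hd : 1 ≤ d) (hn : 1 ≤ n) (T : Tensor F d (Fin n)) (k : ℕ) :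
    circuitComplexity (T.kronPow k).toPoly ≤
      d * ((n ^ (k / d + 1)) ^ (2 * (d - 1) + 1) + 4 * (n ^ (k / d + 1)) ^ (2 * maxBag d)) + 1 := by
  classical
  have : Nonempty (Fin n) := ⟨⟨0, hn⟩⟩
  -- Factor `l` belongs to block `l % d`. On a block, `l ↦ l / d` is injective with values at most
  -- `k / d`.
  let σ : Fin k → Fin d := fun l => ⟨l % d, Nat.mod_lt _ hd⟩
  let I : Fin d → Type := fun c => {l // σ l = c} → Fin n
  have hI : ∀ c, Fintype.card (I c) ≤ n ^ (k / d + 1) := by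
    intro c
    rw [Fintype.card_fun, Fintype.card_fin]
    refine Nat.pow_le_pow_right hn ?_
    rw [← Fintype.card_fin (k / d + 1)]
    refine Fintype.card_le_of_injective
      (fun l => ⟨l.1.1 / d, Nat.lt_succ_of_le (Nat.div_le_div_right l.1.2.le)⟩) ?_
    rintro ⟨l, hl⟩ ⟨l', hl'⟩ h
    have h1 : l.1 / d = l'.1 / d := by simpa using h
    have h2 : l.1 % d = l'.1 % d := by simpa [σ] using congrArg Fin.val (hl.trans hl'.symm)
    have h3 : l.1 = l'.1 := by rw [← Nat.div_add_mod l.1 d, ← Nat.div_add_mod l'.1 d, h1, h2]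
    exact Subtype.ext (Fin.ext h3)
  let κ : Fin d → (∀ p : Fin d × Fin d, I p.1) → F := fun c f =>
    ∏ l : {l // σ l = c}, T fun j => f (c, j) l
  let x : Fin d → (∀ p : Fin d × Fin d, I p.1) → MvPolynomial (Fin d × (Fin k → Fin n)) F :=
    fun j f => MvPolynomial.X (j, fun l => f (σ l, j) ⟨l, rfl⟩)
  have h1 := derives_sum_prod (S := insert 1 (Set.range MvPolynomial.X)) hI (Or.inl rfl) κ x
    (by rintro j _ ⟨f, rfl⟩; exact Or.inr ⟨_, rfl⟩) (by
      intro j f f' h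
      have hκ : κ j f = κ j f' := Finset.prod_congr rfl fun l _ => congrArg T <| funext fun i =>
        congrFun (h (j, i) (Or.inl rfl)) l
      have hx : x j f = x j f' := congrArg (fun v => MvPolynomial.X (j, v)) <| funext fun l =>
        congrFun (h (σ l, j) (Or.inr rfl)) _
      simp only [hκ, hx])
  have h2 : (T.kronPow k).toPoly = ∑ f, ∏ j, (MvPolynomial.C (κ j f) * x j f) := by
    -- The variable at `(c, j)` is the restriction of the index of mode `j` to block `c`.
    let e : (Fin d → Fin k → Fin n) ≃ ∀ p : Fin d × Fin d, I p.1 :=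
      { toFun := fun i p l => i p.2 l.1
        invFun := fun f j l => f (σ l, j) ⟨l, rfl⟩
        left_inv := fun i => rfl
        right_inv := fun f => by
          have h : ∀ c j (l : Fin k) (hl : σ l = c), f (σ l, j) ⟨l, rfl⟩ = f (c, j) ⟨l, hl⟩ := by
            rintro c j l rfl
            rfl
          funext p l
          exact h p.1 p.2 l.1 l.2 }
    rw [toPoly, ← e.sum_comp]
    refine Finset.sum_congr rfl fun i _ => ?_
    rw [Finset.prod_mul_distrib, ← map_prod]
    refine congrArg₂ (fun a b => MvPolynomial.C a * b) ?_ rfl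
    exact (Fintype.prod_fiberwise σ fun l => T fun j => i j l).symm
  rw [← h2] at h1
  have h3 := h1 _ 0 subset_rfl hasCircuit_insert_one_range_X
  rw [zero_add] at h3
  exact h3.circuitComplexity_le (Or.inr rfl)

theorem div_mem_circuitExponents (hd : 1 ≤ d) (hn : 1 ≤ n) (T : Tensor F d (Fin n)) {E : ℕ}
    (h1 : 2 * (d - 1) + 1 ≤ E) (h2 : 2 * maxBag d ≤ E) : (E : ℝ) / d ∈ T.circuitExponents := by
  refine ⟨by positivity, ?_⟩
  have hn' : (1 : ℝ) ≤ n := by exact_mod_cast hn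
  have hd' : (0 : ℝ) < d := by exact_mod_cast hd
  -- The factor `n ^ E` absorbs the `+ 1` in `k / d + 1`, and `5 * d + 1` collects the two kinds of
  -- terms and the output wire.
  refine IsBigO.of_bound ((5 * d + 1) * (n : ℝ) ^ (E : ℝ)) (Eventually.of_forall fun k => ?_)
  rw [Real.norm_of_nonneg (by positivity), Real.norm_of_nonneg (by positivity)]
  have h3 : circuitComplexity (T.kronPow k).toPoly ≤ (5 * d + 1) * (n ^ (k / d + 1)) ^ E := by
    refine (circuitComplexity_kronPow_le hd hn T k).trans ?_
    have hM : 0 < n ^ (k / d + 1) := by positivity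
    have h4 := Nat.pow_le_pow_right hM h1
    have h5 := Nat.pow_le_pow_right hM h2
    have h6 := Nat.pow_pos (n := E) hM
    nlinarith
  have h4 : (((n ^ (k / d + 1)) ^ E : ℕ) : ℝ) ≤
      (n : ℝ) ^ (E : ℝ) * (n : ℝ) ^ ((k : ℝ) * (E / d)) := by
    rw [← Real.rpow_add (by positivity)]
    push_cast
    rw [← pow_mul, ← Real.rpow_natCast]
    refine Real.rpow_le_rpow_of_exponent_le hn' ?_
    have h5 : ((k / d : ℕ) : ℝ) ≤ k / d := Nat.cast_div_le
    push_cast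
    have h6 := mul_le_mul_of_nonneg_right h5 (Nat.cast_nonneg (α := ℝ) E)
    have h7 : (k : ℝ) * (E / d) = k / d * E := by ring
    rw [h7]
    linarith
  calc (circuitComplexity (T.kronPow k).toPoly : ℝ)
      ≤ (5 * d + 1) * (((n ^ (k / d + 1)) ^ E : ℕ) : ℝ) := by exact_mod_cast h3
    _ ≤ (5 * d + 1) * ((n : ℝ) ^ (E : ℝ) * (n : ℝ) ^ ((k : ℝ) * (E / d))) := by gcongr
    _ = _ := by ring

theorem circuitExponent_le {T : Tensor F d (Fin n)} {β : ℝ} (h : β ∈ T.circuitExponents) :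
    T.circuitExponent ≤ β :=
  csInf_le ⟨0, fun _ h => h.1⟩ h

/-- The linear factor `k` in the cost is absorbed by `n ^ (k * ε)`, which grows exponentially
because `n ≥ 2`. -/
theorem one_add_mem_circuitExponents (hn : 2 ≤ n) (T : Tensor F 2 (Fin n)) {ε : ℝ} (hε : 0 < ε) :
    1 + ε ∈ T.circuitExponents := by
  refine ⟨by positivity, ?_⟩
  have hn' : (1 : ℝ) < n := by exact_mod_cast hn
  have hr : 1 < (n : ℝ) ^ ε := Real.one_lt_rpow hn' hε
  have h1 : (fun k : ℕ => (k : ℝ) * n + 5) =O[atTop] fun k : ℕ => ((n : ℝ) ^ ε) ^ k := by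
    have h2 := (isLittleO_coe_const_pow_of_one_lt (R := ℝ) hr).isBigO
    refine ((h2.const_mul_left (n : ℝ)).congr_left fun k => mul_comm _ _).add ?_
    refine IsBigO.of_bound 5 (Eventually.of_forall fun k => ?_)
    rw [Real.norm_of_nonneg (by positivity), Real.norm_of_nonneg (by positivity)]
    linarith [one_le_pow₀ hr.le (n := k)]
  have h3 : (fun k : ℕ => (circuitComplexity (T.kronPow k).toPoly : ℝ)) =O[atTop]
      fun k : ℕ => (n : ℝ) ^ k * ((k : ℝ) * n + 5) := by
    refine IsBigO.of_bound 1 (Eventually.of_forall fun k => ?_)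
    rw [Real.norm_of_nonneg (by positivity), Real.norm_of_nonneg (by positivity), one_mul]
    have h4 := circuitComplexity_kronPow_two_le (by lia) T k
    have h5 : 0 < n ^ k := by positivity
    have h6 : circuitComplexity (T.kronPow k).toPoly ≤ n ^ k * (k * n + 5) := by
      rw [pow_succ] at h4
      nlinarith
    exact_mod_cast h6
  refine h3.trans (((isBigO_refl _ _).mul h1).congr_right fun k => ?_)
  rw [mul_add, mul_one, Real.rpow_add (by positivity), Real.rpow_natCast, mul_comm (k : ℝ) ε,
    Real.rpow_mul (by positivity), Real.rpow_natCast]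

theorem circuitExponent_two_le (hn : 1 ≤ n) (T : Tensor F 2 (Fin n)) : T.circuitExponent ≤ 1 := by
  rcases hn.eq_or_lt with rfl | hn
  -- For `n = 1` all powers of `n` equal `1`, so the bound for exponent `3 / 2` is also one for
  -- exponent `1`.
  · refine circuitExponent_le ⟨zero_le_one, ?_⟩
    have := (div_mem_circuitExponents (by lia) le_rfl T (E := 3) (by lia) (by decide)).2
    simpa using this
  · exact le_of_forall_pos_le_add fun ε hε =>
      circuitExponent_le (one_add_mem_circuitExponents hn T hε)

end Tensor

/-- From three modes on, summing out the loops is no more expensive than the bags. -/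
theorem le_maxBag {d : ℕ} (hd : 3 ≤ d) : 2 * (d - 1) + 1 ≤ 2 * maxBag d := by
  rw [maxBag]
  obtain ⟨e, rfl | rfl⟩ : ∃ e, d = 2 * e ∨ d = 2 * e + 1 := ⟨d / 2, by lia⟩
  · have h1 : 2 * e / 2 = e := by lia
    have h2 : (2 * e + 1) / 2 = e := by lia
    have h3 : 2 ≤ e := by lia
    rw [h1, h2]
    have : 2 * e + 1 ≤ (e + 1) * e := by nlinarith
    lia
  · have h1 : (2 * e + 1) / 2 = e := by lia
    have h2 : (2 * e + 1 + 1) / 2 = e + 1 := by lia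
    rw [h1, h2]
    have : 2 * e + 2 ≤ (e + 1) * (e + 1) := by nlinarith
    lia

theorem two_div_mul_maxBag {d : ℕ} (hd : 1 ≤ d) :
    2 / (d : ℝ) * (maxBag d : ℝ) = (d : ℝ) / 2 + 1 - (7 + (-1 : ℝ) ^ d) / (4 * (d : ℝ)) := by
  have hd' : (d : ℝ) ≠ 0 := by positivity
  have h0 : 1 ≤ (d / 2 + 1) * ((d + 1) / 2) := Nat.mul_pos (by lia) (by lia)
  rw [maxBag, Nat.cast_sub h0]
  obtain ⟨e, rfl | rfl⟩ : ∃ e, d = 2 * e ∨ d = 2 * e + 1 := ⟨d / 2, by lia⟩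
  · have h1 : 2 * e / 2 = e := by lia
    have h2 : (2 * e + 1) / 2 = e := by lia
    rw [h1, h2, Even.neg_one_pow (even_two_mul e)]
    push_cast at hd' ⊢
    have he : (e : ℝ) ≠ 0 := fun h => hd' (by rw [h, mul_zero])
    field_simp
    ring
  · have h1 : (2 * e + 1) / 2 = e := by lia
    have h2 : (2 * e + 1 + 1) / 2 = e + 1 := by lia
    rw [h1, h2, Odd.neg_one_pow (odd_two_mul_add_one e)]
    push_cast at hd' ⊢
    field_simp
    ring

theorem mainTheorem4 {F : Type*} [Field F] (d n : ℕ) (hd : 1 ≤ d) (hn : 1 ≤ n)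
    (T : Tensor F d (Fin n)) :
    T.circuitExponents.Nonempty ∧
    (2 ≤ d → T.circuitExponent ≤
      2 / (d : ℝ) * (((⊤ : SimpleGraph (Fin d)).lineTreewidth : ℝ) + 1)) ∧
    2 / (d : ℝ) * (((⊤ : SimpleGraph (Fin d)).lineTreewidth : ℝ) + 1) =
      (d : ℝ) / 2 + 1 - (7 + (-1 : ℝ) ^ d) / (4 * (d : ℝ)) ∧
    (d : ℝ) / 2 + 1 - (7 + (-1 : ℝ) ^ d) / (4 * (d : ℝ)) < (d : ℝ) / 2 + 1 ∧
    T.circuitExponent < (d : ℝ) / 2 + 1 := by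
  have hltw : ((⊤ : SimpleGraph (Fin d)).lineTreewidth : ℝ) + 1 = maxBag d := by
    rw [SimpleGraph.lineTreewidth_top hd]
    push_cast
    ring
  have hlt : (d : ℝ) / 2 + 1 - (7 + (-1 : ℝ) ^ d) / (4 * (d : ℝ)) < (d : ℝ) / 2 + 1 := by
    refine sub_lt_self _ (div_pos ?_ (by positivity))
    rcases neg_one_pow_eq_or ℝ d with h | h <;> rw [h] <;> norm_num
  have hle : 2 ≤ d → T.circuitExponent ≤ 2 / (d : ℝ) * (maxBag d : ℝ) := by
    intro h2
    rcases h2.eq_or_lt with rfl | h3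
    · have : maxBag 2 = 1 := rfl
      simpa [this] using T.circuitExponent_two_le hn
    · refine (Tensor.circuitExponent_le (T.div_mem_circuitExponents hd hn (le_maxBag h3)
        le_rfl)).trans (le_of_eq ?_)
      push_cast
      ring
  rw [hltw]
  refine ⟨⟨_, T.div_mem_circuitExponents hd hn (le_max_left _ _) (le_max_right _ _)⟩, hle,
    two_div_mul_maxBag hd, hlt, ?_⟩
  rcases hd.eq_or_lt with rfl | h2
  -- For `d = 1` the bag is empty and the loop term alone gives exponent `1 < 3 / 2`.
  · refine (Tensor.circuitExponent_le (T.div_mem_circuitExponents le_rfl hn (E := 1) (by lia)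
      (by decide))).trans_lt ?_
    norm_num
  · exact (hle h2).trans_lt ((two_div_mul_maxBag hd).trans_lt hlt)

end
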